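/- Let $1<c<2$ and let $u$ be a real number with $u>2+\frac{4(c-1)}{2-c}$. Write $\mathbb N^c=\{\lfloor k^c\rfloor:k\in\mathbb N\}$. For real $X>e^e$ put $w=\log\log\log\log X$, $W=\prod_{p\le w,\ p\text{ prime}}p$ (an empty product being $1$) and $N=\lfloor X/W\rfloor+1$. For an integer $b$ with $0\le b<W$ and $\gcd(b,W)=1$, and for $n\in\mathbb Z$, let $$ \tau_{W,b}^{(c)}(n)=\begin{cases}c\,m^{1-\frac1c},&\text{if } m=Wn-b\in\mathbb N^c\cap[1,X],\\ 0,&\text{otherwise.}\end{cases} $$ Then there is a constant $C$, depending only on $c$ and $u$, such that for all such $X$ and $b$ and every function $f:\mathbb Z\to\mathbb C$ with $|f(n)|\le\tau_{W,b}^{(c)}(n)$ for all $n\in\mathbb Z$, $$ \int_0^1|\hat f(\alpha)|^u\,d\alpha\le C\,N^{u-1},\qquad\text{where }\hat f(\alpha)=\sum_{n\in\mathbb Z}f(n)e^{2\pi i n\alpha}. $$ -/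

import Mathlib

namespace PiatetskiShapiro

/-- The set `ℕ^c = {⌊n^c⌋ : n ∈ ℕ}` of Piatetski-Shapiro integers. -/
def psSet (c : ℝ) : Set ℤ := {m | ∃ k : ℕ, m = ⌊(k : ℝ) ^ c⌋}

/-- The modulus `W`, the product of all primes `p ≤ w`, where `w = log log log log X`
(the empty product `1` if `w < 2`). -/
noncomputable def trickW (X : ℝ) : ℕ :=
  primorial ⌊Real.log (Real.log (Real.log (Real.log X)))⌋₊

/-- The length `N = ⌊X / W⌋ + 1`, with `W` as above. -/
noncomputable def trickN (X : ℝ) : ℕ := ⌊X / (trickW X : ℝ)⌋₊ + 1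

open Classical in
/-- The function that takes the value `c m^(1 - 1/c)` at `n` if `m = W n - b` lies in
`ℕ^c ∩ [1, X]`, and the value `0` otherwise. -/
noncomputable def tau (c : ℝ) (W b : ℕ) (X : ℝ) (n : ℤ) : ℝ :=
  if (W : ℤ) * n - b ∈ psSet c ∧ 1 ≤ (W : ℤ) * n - b ∧ (((W : ℤ) * n - b : ℤ) : ℝ) ≤ X then
    c * (((W : ℤ) * n - b : ℤ) : ℝ) ^ (1 - 1 / c)
  else 0

/-- The Fourier transform `∑ n, f n e(n θ)`, where `e(x) = exp (2 π i x)`. It is used here for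
finitely supported `f` only. -/
noncomputable def fourierSum (f : ℤ → ℂ) (θ : ℝ) : ℂ :=
  ∑' n : ℤ, f n * Complex.exp (2 * Real.pi * Complex.I * (n * θ))

end PiatetskiShapiro

/-!
The estimate is transferred to `f` from a majorant of `τ` whose Fourier transform is small away from
`0`. An integer `m` lies in `ℕ^c` only if `m^γ`, `γ = 1/c`, is within about `m^(γ - 1)` of an
integer, so `τ` is dominated by a Fejér kernel of degree `≍ m^(1 - γ)` evaluated at `m^γ`. The
constant term of that kernel contributes a Dirichlet kernel `≪ N / (1 + N ‖α‖)`. The other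
frequencies contribute the sums of `e(ξ m^γ + n α)`, for which van der Corput's second derivative
test gives `≪ W^2 X^(3/2 - γ)`, a power of `X` less than `N` when `W` is tiny.

For a majorant `ν` with `‖ν̂‖ ≤ k + D`, let `F = f̂` and restrict attention to the set where
`‖F‖ ^ 2` exceeds `2 D ∑ ν n`. There duality (the `T T*` method) together with Young's inequality
bounds `∫ ‖F‖ ^ u` by a norm of `k`, while on the complement Parseval's identity suffices. The
threshold for `u` is what this last step needs, because `‖f‖` may be as large as `X ^ (1 - γ)`.
-/

namespace PiatetskiShapiro

open Finset FourierTransform fwdDiff MeasureTheory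
open scoped ComplexConjugate

/-! ### The Kusmin–Landau inequality -/

lemma fourierChar_intCast (n : ℤ) : (𝐞 (n : ℝ) : ℂ) = 1 := by
  rw [Real.fourierChar_apply, Complex.exp_eq_one_iff]
  exact ⟨n, by push_cast; ring⟩

lemma fourierChar_add (x y : ℝ) : (𝐞 (x + y) : ℂ) = 𝐞 x * 𝐞 y := by
  rw [AddChar.map_add_eq_mul, Circle.coe_mul]

lemma fourierChar_add_intCast (x : ℝ) (n : ℤ) : (𝐞 (x + n) : ℂ) = 𝐞 x := by
  rw [fourierChar_add, fourierChar_intCast, mul_one]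

lemma fourierChar_neg (x : ℝ) : (𝐞 (-x) : ℂ) = conj (𝐞 x : ℂ) := by
  rw [AddChar.map_neg_eq_inv, Circle.coe_inv_eq_conj]

lemma norm_one_sub_fourierChar (x : ℝ) : ‖1 - (𝐞 x : ℂ)‖ = 2 * |Real.sin (Real.pi * x)| := by
  rw [norm_sub_rev, Real.fourierChar_apply, mul_comm, Complex.norm_exp_I_mul_ofReal_sub_one,
    norm_mul, Real.norm_eq_abs, Real.norm_eq_abs, abs_two]
  ring_nf

lemma inv_one_sub_fourierChar {x : ℝ} (hx : Real.sin (Real.pi * x) ≠ 0) :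
    (1 - (𝐞 x : ℂ))⁻¹ = 1 / 2 + (Real.cot (Real.pi * x) / 2 : ℝ) * Complex.I := by
  have hne : 1 - (𝐞 x : ℂ) ≠ 0 := by
    rw [← norm_ne_zero_iff, norm_one_sub_fourierChar]
    positivity
  have hcot := Complex.cot_pi_eq_exp_ratio x
  rw [show 2 * Real.pi * Complex.I * x = ((2 * Real.pi * x : ℝ) : ℂ) * Complex.I by
    push_cast; ring, ← Real.fourierChar_apply] at hcot
  rw [Complex.ofReal_div, Complex.ofReal_cot, Complex.ofReal_mul, hcot, Complex.ofReal_ofNat]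
  have := Complex.I_ne_zero
  field_simp
  ring

lemma two_mul_le_sin_pi_mul {x d : ℝ} (hd : 0 ≤ d) (hx : x ∈ Set.Icc d (1 - d)) :
    2 * d ≤ Real.sin (Real.pi * x) := by
  obtain ⟨h₁, h₂⟩ := hx
  have hpi := Real.pi_pos
  have jordan {y : ℝ} (h₀ : 0 ≤ y) (hy : y ≤ 1 / 2) : 2 * y ≤ Real.sin (Real.pi * y) := by
    have := Real.mul_le_sin (x := Real.pi * y) (by positivity) (by nlinarith)
    rwa [← mul_assoc, div_mul_cancel₀ _ hpi.ne'] at this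
  rcases le_total x (1 / 2) with h | h
  · linarith [jordan (hd.trans h₁) h]
  · have := jordan (y := 1 - x) (by linarith) (by linarith)
    rw [mul_one_sub Real.pi, Real.sin_pi_sub] at this
    linarith

lemma antitoneOn_cot_pi_mul : AntitoneOn (fun x : ℝ ↦ Real.cot (Real.pi * x)) (Set.Ioo 0 1) := by
  rintro x ⟨hx₀, hx₁⟩ y ⟨hy₀, hy₁⟩ hxy
  have hpi := Real.pi_pos
  have hsx := Real.sin_pos_of_pos_of_lt_pi (x := Real.pi * x) (by positivity) (by nlinarith)
  have hsy := Real.sin_pos_of_pos_of_lt_pi (x := Real.pi * y) (by positivity) (by nlinarith)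
  have hsub := Real.sin_nonneg_of_nonneg_of_le_pi (x := Real.pi * y - Real.pi * x)
    (by nlinarith) (by nlinarith)
  rw [Real.sin_sub] at hsub
  simp only [Real.cot_eq_cos_div_sin]
  rw [div_le_div_iff₀ hsy hsx]
  linarith

lemma sum_range_eq_of_eq_sub_mul {R : Type*} [CommRing R] {w z : ℕ → R} (n : ℕ)
    (h : ∀ i ≤ n, w i = (w i - w (i + 1)) * z i) :
    ∑ i ∈ range (n + 1), w i =
      w 0 * z 0 + ∑ i ∈ range n, w (i + 1) * (z (i + 1) - z i) - w (n + 1) * z n := by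
  induction n with
  | zero => simpa [sub_mul] using h 0 le_rfl
  | succ n ih =>
    rw [sum_range_succ, ih fun i hi ↦ h i (by lia), sum_range_succ _ n]
    linear_combination h (n + 1) le_rfl

lemma norm_sum_range_le_of_eq_sub_mul {w z : ℕ → ℂ} (n : ℕ) (hw : ∀ i, ‖w i‖ ≤ 1)
    (h : ∀ i ≤ n, w i = (w i - w (i + 1)) * z i) :
    ‖∑ i ∈ range (n + 1), w i‖ ≤ ‖z 0‖ + ∑ i ∈ range n, ‖z (i + 1) - z i‖ + ‖z n‖ := by
  have hmul (i : ℕ) (y : ℂ) : ‖w i * y‖ ≤ ‖y‖ := by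
    rw [norm_mul]
    exact mul_le_of_le_one_left (norm_nonneg y) (hw i)
  rw [sum_range_eq_of_eq_sub_mul n h]
  exact (norm_sub_le _ _).trans <| add_le_add ((norm_add_le _ _).trans <|
    add_le_add (hmul _ _) (norm_sum_le_of_le _ fun i _ ↦ hmul _ _)) (hmul _ _)

lemma eq_Icc_of_ordConnected {s : Finset ℤ} (hs : (s : Set ℤ).OrdConnected) (hne : s.Nonempty) :
    s = Icc (s.min' hne) (s.max' hne) := by
  refine Subset.antisymm (fun i hi ↦ mem_Icc.2 ⟨s.min'_le i hi, s.le_max' i hi⟩) fun i hi ↦ ?_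
  exact hs.out (s.min'_mem hne) (s.max'_mem hne) (mem_Icc.1 hi)

lemma exists_eq_map_range_of_ordConnected {s : Finset ℤ} (hs : (s : Set ℤ).OrdConnected) :
    ∃ a : ℤ, s = (range #s).map (Nat.castEmbedding.trans (addLeftEmbedding a)) := by
  rcases s.eq_empty_or_nonempty with rfl | hne
  · exact ⟨0, rfl⟩
  have hIcc := eq_Icc_of_ordConnected hs hne
  have hcard := congrArg card hIcc
  rw [Int.card_Icc] at hcard
  refine ⟨s.min' hne, ext fun i ↦ ?_⟩
  rw [hcard]
  nth_rw 1 [hIcc]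
  simp only [mem_Icc, mem_map, mem_range, Function.Embedding.trans_apply, Nat.castEmbedding_apply,
    addLeftEmbedding_apply]
  exact ⟨fun hi ↦ ⟨(i - s.min' hne).toNat, by lia, by lia⟩, by rintro ⟨j, hj, rfl⟩; lia⟩

lemma norm_inv_one_sub_fourierChar_le {x d : ℝ} (hd : 0 < d) (hx : x ∈ Set.Icc d (1 - d)) :
    ‖(1 - (𝐞 x : ℂ))⁻¹‖ ≤ 1 / (4 * d) := by
  have hsin := two_mul_le_sin_pi_mul hd.le hx
  rw [norm_inv, norm_one_sub_fourierChar, inv_eq_one_div, abs_of_nonneg (by linarith)]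
  exact one_div_le_one_div_of_le (by positivity) (by linarith)

lemma abs_cot_pi_mul_le {x d : ℝ} (hd : 0 < d) (hx : x ∈ Set.Icc d (1 - d)) :
    |Real.cot (Real.pi * x)| ≤ 1 / (2 * d) := by
  have hsin := two_mul_le_sin_pi_mul hd.le hx
  rw [Real.cot_eq_cos_div_sin, abs_div]
  exact div_le_div₀ zero_le_one (Real.abs_cos_le_one _) (by positivity)
    (hsin.trans (le_abs_self _))

lemma norm_inv_one_sub_fourierChar_sub {x y : ℝ} (hx : 0 < x) (hxy : x ≤ y) (hy : y < 1) :
    ‖(1 - (𝐞 y : ℂ))⁻¹ - (1 - (𝐞 x : ℂ))⁻¹‖ =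
      (Real.cot (Real.pi * x) - Real.cot (Real.pi * y)) / 2 := by
  have hsin {t : ℝ} (h₀ : 0 < t) (h₁ : t < 1) : Real.sin (Real.pi * t) ≠ 0 :=
    (Real.sin_pos_of_pos_of_lt_pi (by positivity) (by nlinarith [Real.pi_pos])).ne'
  have hcot := antitoneOn_cot_pi_mul ⟨hx, hxy.trans_lt hy⟩ ⟨hx.trans_le hxy, hy⟩ hxy
  rw [inv_one_sub_fourierChar (hsin hx (hxy.trans_lt hy)),
    inv_one_sub_fourierChar (hsin (hx.trans_le hxy) hy), add_sub_add_left_eq_sub, ← sub_mul,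
    ← Complex.ofReal_sub, norm_mul, Complex.norm_I, mul_one, Complex.norm_real, Real.norm_eq_abs,
    abs_sub_comm, abs_of_nonneg (by linarith)]
  ring

lemma sum_norm_inv_one_sub_fourierChar_sub_le {x : ℕ → ℝ} {n : ℕ} {d : ℝ} (hd : 0 < d)
    (hmono : ∀ i < n, x i ≤ x (i + 1)) (hx : ∀ i ≤ n, x i ∈ Set.Icc d (1 - d)) :
    ∑ i ∈ range n, ‖(1 - (𝐞 (x (i + 1)) : ℂ))⁻¹ - (1 - (𝐞 (x i) : ℂ))⁻¹‖ ≤ 1 / (2 * d) := by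
  have hterm (i : ℕ) (hi : i ∈ range n) :
      ‖(1 - (𝐞 (x (i + 1)) : ℂ))⁻¹ - (1 - (𝐞 (x i) : ℂ))⁻¹‖ =
        Real.cot (Real.pi * x i) / 2 - Real.cot (Real.pi * x (i + 1)) / 2 := by
    rw [mem_range] at hi
    rw [norm_inv_one_sub_fourierChar_sub (hd.trans_le (hx i hi.le).1) (hmono i hi)
      ((hx (i + 1) hi).2.trans_lt (by linarith)), sub_div]
  rw [sum_congr rfl hterm, sum_range_sub' fun i ↦ Real.cot (Real.pi * x i) / 2]
  linarith [abs_le.1 (abs_cot_pi_mul_le hd (hx 0 n.zero_le)),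
    abs_le.1 (abs_cot_pi_mul_le hd (hx n le_rfl))]

theorem norm_sum_fourierChar_le_of_fwdDiff {f : ℤ → ℝ} {s : Finset ℤ} {v : ℤ} {d : ℝ}
    (hd : 0 < d) (hs : (s : Set ℤ).OrdConnected) (hmono : MonotoneOn (Δ_[1] f) s)
    (hf : ∀ i ∈ s, Δ_[1] f i - v ∈ Set.Icc d (1 - d)) :
    ‖∑ i ∈ s, (𝐞 (f i) : ℂ)‖ ≤ 1 / d := by
  obtain ⟨a, ha⟩ := exists_eq_map_range_of_ordConnected hs
  rcases hn : #s with _ | n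
  · rw [card_eq_zero.1 hn, sum_empty, norm_zero]
    positivity
  rw [hn] at ha
  have hmem (i : ℕ) (hi : i ≤ n) : a + i ∈ s := by
    rw [ha, mem_map]
    exact ⟨i, mem_range.2 (by lia), rfl⟩
  let x (i : ℕ) : ℝ := Δ_[1] f (a + i) - v
  have hx (i : ℕ) (hi : i ≤ n) : x i ∈ Set.Icc d (1 - d) := hf _ (hmem i hi)
  have hstep (i : ℕ) (hi : i ≤ n) : (𝐞 (f (a + i)) : ℂ) =
      (𝐞 (f (a + i)) - 𝐞 (f (a + (i + 1 : ℕ)))) * (1 - (𝐞 (x i) : ℂ))⁻¹ := by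
    have hne : 1 - (𝐞 (x i) : ℂ) ≠ 0 := by
      rw [← norm_ne_zero_iff, norm_one_sub_fourierChar]
      linarith [two_mul_le_sin_pi_mul hd.le (hx i hi), le_abs_self (Real.sin (Real.pi * x i))]
    have hnext : f (a + (i + 1 : ℕ)) = f (a + i) + x i + v := by
      simp only [x, fwdDiff]
      push_cast
      ring_nf
    rw [hnext, fourierChar_add_intCast, fourierChar_add, ← mul_one_sub, mul_inv_cancel_right₀ hne]
  have hvar := sum_norm_inv_one_sub_fourierChar_sub_le hd
    (fun i hi ↦ sub_le_sub_right (hmono (hmem i hi.le) (hmem (i + 1) hi) (by lia)) _) hx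
  calc ‖∑ i ∈ s, (𝐞 (f i) : ℂ)‖ = ‖∑ i ∈ range (n + 1), (𝐞 (f (a + i)) : ℂ)‖ := by
        rw [ha, sum_map]
        rfl
    _ ≤ 1 / (4 * d) + 1 / (2 * d) + 1 / (4 * d) :=
        (norm_sum_range_le_of_eq_sub_mul n (fun i ↦ (Circle.norm_coe _).le) hstep).trans <|
          add_le_add_three (norm_inv_one_sub_fourierChar_le hd (hx 0 n.zero_le)) hvar
            (norm_inv_one_sub_fourierChar_le hd (hx n le_rfl))
    _ = 1 / d := by
        field_simp
        norm_num

/-! ### Van der Corput's second derivative test -/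

lemma sub_mem_Icc_of_fwdDiff_mem_Icc {g : ℤ → ℝ} {s : Finset ℤ} {l M : ℝ}
    (hs : (s : Set ℤ).OrdConnected) (hg : ∀ i ∈ s, Δ_[1] g i ∈ Set.Icc l M) {i j : ℤ} (hi : i ∈ s)
    (hj : j ∈ s) (hij : i ≤ j) : g j - g i ∈ Set.Icc (l * (j - i)) (M * (j - i)) := by
  induction j, hij using Int.leInduction with
  | base => simp
  | succ j hij ih =>
    have hjs : j ∈ s := hs.out hi hj ⟨hij, by lia⟩
    obtain ⟨ih₁, ih₂⟩ := ih hjs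
    obtain ⟨h₁, h₂⟩ := hg j hjs
    rw [fwdDiff] at h₁ h₂
    push_cast
    constructor <;> linarith

lemma monotoneOn_of_fwdDiff_mem_Icc {g : ℤ → ℝ} {s : Finset ℤ} {l M : ℝ} (hl : 0 ≤ l)
    (hs : (s : Set ℤ).OrdConnected) (hg : ∀ i ∈ s, Δ_[1] g i ∈ Set.Icc l M) :
    MonotoneOn g s := fun i hi j hj hij ↦ by
  have := (sub_mem_Icc_of_fwdDiff_mem_Icc hs hg hi hj hij).1
  have : (0 : ℝ) ≤ j - i := sub_nonneg.2 (by exact_mod_cast hij)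
  nlinarith

lemma ordConnected_filter_mem {g : ℤ → ℝ} {s : Finset ℤ} {I : Set ℝ}
    (hs : (s : Set ℤ).OrdConnected) (hg : MonotoneOn g s) (hI : I.OrdConnected) :
    ({i ∈ s | g i ∈ I} : Set ℤ).OrdConnected := by
  refine ⟨fun i hi j hj k hk ↦ ?_⟩
  have hks : k ∈ s := hs.out hi.1 hj.1 hk
  exact ⟨hks, hI.out hi.2 hj.2 ⟨hg hi.1 hks hk.1, hg hks hj.1 hk.2⟩⟩

lemma card_le_of_spaced {g : ℤ → ℝ} {t : Finset ℤ} {p l d : ℝ} (hl : 0 < l) (hd : 0 ≤ d)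
    (hg : ∀ i ∈ t, ∀ j ∈ t, i ≤ j → l * (j - i) ≤ g j - g i)
    (hmem : ∀ i ∈ t, g i ∈ Set.Icc p (p + d)) : (#t : ℝ) ≤ d / l + 1 := by
  rcases t.eq_empty_or_nonempty with rfl | hne
  · rw [card_empty, Nat.cast_zero]
    positivity
  have hle := t.min'_le _ (t.max'_mem hne)
  have hcard := card_le_card (t := Icc (t.min' hne) (t.max' hne)) fun i hi ↦
    mem_Icc.2 ⟨t.min'_le i hi, t.le_max' i hi⟩
  rw [Int.card_Icc] at hcard
  have hcard' : (#t : ℝ) ≤ t.max' hne - t.min' hne + 1 := by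
    exact_mod_cast (show (#t : ℤ) ≤ t.max' hne - t.min' hne + 1 by lia)
  have hdiam : (t.max' hne - t.min' hne : ℝ) ≤ d / l := by
    rw [le_div_iff₀' hl]
    linarith [hg _ (t.min'_mem hne) _ (t.max'_mem hne) hle, (hmem _ (t.min'_mem hne)).1,
      (hmem _ (t.max'_mem hne)).2]
  linarith

lemma norm_sum_fourierChar_le_card (f : ℤ → ℝ) (s : Finset ℤ) :
    ‖∑ i ∈ s, (𝐞 (f i) : ℂ)‖ ≤ #s := by
  simpa only [Circle.norm_coe, sum_const, nsmul_one] using norm_sum_le s fun i ↦ (𝐞 (f i) : ℂ)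

/-- On a block where the first difference stays in a unit interval `[v, v + 1)`, the terms with
first difference within `√l` of an endpoint are few, and Kusmin–Landau applies to the others. -/
lemma norm_sum_fourierChar_le_of_floor_eq {f : ℤ → ℝ} {s : Finset ℤ} {l M : ℝ} {v : ℤ}
    (hl : 0 < l) (hl4 : l ≤ 1 / 4) (hs : (s : Set ℤ).OrdConnected)
    (hf : ∀ i ∈ s, Δ_[1] (Δ_[1] f) i ∈ Set.Icc l M) (hv : ∀ i ∈ s, ⌊Δ_[1] f i⌋ = v) :
    ‖∑ i ∈ s, (𝐞 (f i) : ℂ)‖ ≤ 4 / √l := by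
  classical
  set g := Δ_[1] f
  set d := √l
  have hd : 0 < d := Real.sqrt_pos.2 hl
  have hd2 : 2 ≤ 1 / d := by
    rw [le_div_iff₀ hd, mul_comm, ← le_div_iff₀ two_pos]
    exact (Real.sqrt_le_left (by norm_num)).2 (by linarith)
  have hdl : d / l = 1 / d := by
    rw [div_eq_div_iff hl.ne' hd.ne', one_mul, Real.mul_self_sqrt hl.le]
  have hmono : MonotoneOn g s := monotoneOn_of_fwdDiff_mem_Icc hl.le hs hf
  have hends (p : ℝ) : (#{i ∈ s | g i ∈ Set.Icc p (p + d)} : ℝ) ≤ 1 / d + 1 := by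
    rw [← hdl]
    refine card_le_of_spaced hl hd.le (fun i hi j hj hij ↦ ?_) fun i hi ↦ (mem_filter.1 hi).2
    exact (sub_mem_Icc_of_fwdDiff_mem_Icc hs hf (mem_filter.1 hi).1 (mem_filter.1 hj).1 hij).1
  have hmiddle : ‖∑ i ∈ s with g i ∈ Set.Icc (v + d) (v + 1 - d), (𝐞 (f i) : ℂ)‖ ≤ 1 / d := by
    refine norm_sum_fourierChar_le_of_fwdDiff (v := v) hd ?_
      (hmono.mono (coe_subset.2 (filter_subset _ _))) fun i hi ↦ ?_
    · rw [coe_filter]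
      exact ordConnected_filter_mem hs hmono Set.ordConnected_Icc
    · obtain ⟨-, h₁, h₂⟩ := mem_filter.1 hi
      constructor <;> linarith
  have hcard : (#{i ∈ s | g i ∉ Set.Icc (v + d) (v + 1 - d)} : ℝ) ≤ 2 * (1 / d + 1) := by
    have hsub : {i ∈ s | g i ∉ Set.Icc (v + d) (v + 1 - d)} ⊆
        {i ∈ s | g i ∈ Set.Icc (v : ℝ) (v + d)} ∪
          {i ∈ s | g i ∈ Set.Icc (v + 1 - d) (v + 1 - d + d)} := fun i hi ↦ by
      obtain ⟨his, hi⟩ := mem_filter.1 hi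
      obtain ⟨h₁, h₂⟩ := Int.floor_eq_iff.1 (hv i his)
      rw [mem_union, mem_filter, mem_filter, Set.mem_Icc, Set.mem_Icc]
      grind
    have : (#{i ∈ s | g i ∉ Set.Icc (v + d) (v + 1 - d)} : ℝ) ≤ _ :=
      Nat.cast_le.2 ((card_le_card hsub).trans (card_union_le _ _))
    push_cast at this
    linarith [hends v, hends (v + 1 - d)]
  rw [← sum_filter_add_sum_filter_not s (g · ∈ Set.Icc (v + d) (v + 1 - d))]
  refine (norm_add_le _ _).trans ?_
  rw [show 4 / d = 4 * (1 / d) by ring]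
  linarith [norm_sum_fourierChar_le_card f {i ∈ s | g i ∉ Set.Icc (v + d) (v + 1 - d)}]

theorem norm_sum_fourierChar_le_of_fwdDiff_fwdDiff {f : ℤ → ℝ} {s : Finset ℤ} {l M : ℝ}
    (hl : 0 < l) (hl4 : l ≤ 1 / 4) (hs : (s : Set ℤ).OrdConnected)
    (hf : ∀ i ∈ s, Δ_[1] (Δ_[1] f) i ∈ Set.Icc l M) :
    ‖∑ i ∈ s, (𝐞 (f i) : ℂ)‖ ≤ (M * #s + 2) * (4 / √l) := by
  classical
  rcases s.eq_empty_or_nonempty with rfl | hne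
  · rw [sum_empty, norm_zero, card_empty, Nat.cast_zero, mul_zero, zero_add]
    positivity
  have hmono : MonotoneOn (Δ_[1] f) s := monotoneOn_of_fwdDiff_mem_Icc hl.le hs hf
  obtain ⟨hmin, hmax⟩ := And.intro (s.min'_mem hne) (s.max'_mem hne)
  have hle := s.min'_le _ hmax
  have hM : 0 ≤ M := hl.le.trans ((hf _ hmin).1.trans (hf _ hmin).2)
  have hblock (v : ℤ) : ‖∑ i ∈ s with ⌊Δ_[1] f i⌋ = v, (𝐞 (f i) : ℂ)‖ ≤ 4 / √l := by
    refine norm_sum_fourierChar_le_of_floor_eq hl hl4 ?_ (fun i hi ↦ hf i (mem_filter.1 hi).1)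
      fun i hi ↦ (mem_filter.1 hi).2
    rw [coe_filter]
    exact ordConnected_filter_mem (I := {y | ⌊y⌋ = v}) hs hmono
      (Set.ordConnected_singleton.preimage_mono Int.floor_mono)
  have hcount : (#(Icc ⌊Δ_[1] f (s.min' hne)⌋ ⌊Δ_[1] f (s.max' hne)⌋) : ℝ) ≤ M * #s + 2 := by
    have hfloor := Int.floor_mono (hmono hmin hmax hle)
    have hcard := congrArg card (eq_Icc_of_ordConnected hs hne)
    rw [Int.card_Icc] at hcard ⊢
    have hlen : (s.max' hne - s.min' hne : ℝ) ≤ #s := by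
      exact_mod_cast (show s.max' hne - s.min' hne ≤ #s by lia)
    have hnum : ((⌊Δ_[1] f (s.max' hne)⌋ + 1 - ⌊Δ_[1] f (s.min' hne)⌋).toNat : ℝ) =
        ⌊Δ_[1] f (s.max' hne)⌋ + 1 - ⌊Δ_[1] f (s.min' hne)⌋ := by
      exact_mod_cast Int.toNat_of_nonneg (by lia)
    rw [hnum]
    linarith [(sub_mem_Icc_of_fwdDiff_mem_Icc hs hf hmin hmax hle).2,
      Int.floor_le (Δ_[1] f (s.max' hne)),
      Int.sub_one_lt_floor (Δ_[1] f (s.min' hne)), mul_le_mul_of_nonneg_left hlen hM]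
  rw [← sum_fiberwise_of_maps_to fun i hi ↦ mem_Icc.2
    ⟨Int.floor_mono (hmono hmin hi (s.min'_le i hi)),
      Int.floor_mono (hmono hi hmax (s.le_max' i hi))⟩]
  calc _ ≤ #(Icc ⌊Δ_[1] f (s.min' hne)⌋ ⌊Δ_[1] f (s.max' hne)⌋) • (4 / √l) :=
        (norm_sum_le _ _).trans (sum_le_card_nsmul _ _ _ fun v _ ↦ hblock v)
    _ ≤ (M * #s + 2) * (4 / √l) := by
        rw [nsmul_eq_mul]
        gcongr

lemma exists_fwdDiff_fwdDiff_eq {f f' f'' : ℝ → ℝ} {x w : ℝ} (hw : 0 < w)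
    (hf : ∀ y ∈ Set.Icc x (x + 2 * w), HasDerivAt f (f' y) y)
    (hf' : ∀ y ∈ Set.Icc x (x + 2 * w), HasDerivAt f' (f'' y) y) :
    ∃ y ∈ Set.Icc x (x + 2 * w), Δ_[w] (Δ_[w] f) x = w ^ 2 * f'' y := by
  have hΔ (y : ℝ) (hy : y ∈ Set.Icc x (x + w)) : HasDerivAt (Δ_[w] f) (f' (y + w) - f' y) y :=
    ((hf _ ⟨by linarith [hy.1], by linarith [hy.2]⟩).comp_add_const y w).sub
      (hf _ ⟨hy.1, by linarith [hy.2]⟩)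
  obtain ⟨a, ⟨ha₁, ha₂⟩, ha⟩ := exists_hasDerivAt_eq_slope (Δ_[w] f) (fun y ↦ f' (y + w) - f' y)
    (by linarith : x < x + w) (fun y hy ↦ (hΔ y hy).continuousAt.continuousWithinAt)
    fun y hy ↦ hΔ y (Set.Ioo_subset_Icc_self hy)
  have hsub (y : ℝ) (hy : y ∈ Set.Icc a (a + w)) : y ∈ Set.Icc x (x + 2 * w) :=
    ⟨by linarith [hy.1], by linarith [hy.2]⟩
  obtain ⟨z, hz, hz'⟩ := exists_hasDerivAt_eq_slope f' f'' (by linarith : a < a + w)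
    (fun y hy ↦ (hf' y (hsub y hy)).continuousAt.continuousWithinAt)
    fun y hy ↦ hf' y (hsub y (Set.Ioo_subset_Icc_self hy))
  refine ⟨z, hsub z (Set.Ioo_subset_Icc_self hz), ?_⟩
  rw [add_sub_cancel_left, eq_div_iff hw.ne'] at ha hz'
  rw [fwdDiff]
  linear_combination -ha - w * hz'

lemma exists_fwdDiff_fwdDiff_rpow_eq {x w : ℝ} (hx : 0 < x) (hw : 0 < w) (γ : ℝ) :
    ∃ y ∈ Set.Icc x (x + 2 * w),
      Δ_[w] (Δ_[w] (fun t : ℝ ↦ t ^ γ)) x = w ^ 2 * (γ * ((γ - 1) * y ^ (γ - 2))) := by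
  refine exists_fwdDiff_fwdDiff_eq (f' := fun y ↦ γ * y ^ (γ - 1)) hw
    (fun y hy ↦ Real.hasDerivAt_rpow_const (.inl (hx.trans_le hy.1).ne')) fun y hy ↦ ?_
  rw [show γ - 2 = γ - 1 - 1 by ring]
  exact (Real.hasDerivAt_rpow_const (.inl (hx.trans_le hy.1).ne')).const_mul γ

lemma fwdDiff_fwdDiff_phase_mem_Icc {γ w b Y ξ : ℝ} {n : ℤ} (hγ : γ ∈ Set.Ioo 0 1) (hw : 1 ≤ w)
    (hY : 1 ≤ Y) (hn : w * n - b ∈ Set.Icc Y (2 * Y)) (hξ : 0 < ξ) (x : ℝ) :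
    Δ_[1] (Δ_[1] fun k : ℤ ↦ -ξ * (w * k - b) ^ γ + k * x) n ∈
      Set.Icc (γ * (1 - γ) * ξ * Y ^ (γ - 2) / 16)
        (16 * w ^ 2 * (γ * (1 - γ) * ξ * Y ^ (γ - 2) / 16)) := by
  obtain ⟨hγ₀, hγ₁⟩ := hγ
  obtain ⟨hn₁, hn₂⟩ := hn
  have : 0 < γ * (1 - γ) := mul_pos hγ₀ (sub_pos.2 hγ₁)
  have hY₀ : 0 < Y := by linarith
  obtain ⟨y, ⟨hy₁, hy₂⟩, hy⟩ := exists_fwdDiff_fwdDiff_rpow_eq (x := w * n - b)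
    (hY₀.trans_le hn₁) (by linarith : 0 < w) γ
  have hΔ : Δ_[1] (Δ_[1] fun k : ℤ ↦ -ξ * (w * k - b) ^ γ + k * x) n =
      γ * (1 - γ) * ξ * w ^ 2 * y ^ (γ - 2) := by
    simp only [fwdDiff] at hy ⊢
    push_cast
    ring_nf at hy ⊢
    linear_combination -ξ * hy
  have hupper : y ^ (γ - 2) ≤ Y ^ (γ - 2) :=
    Real.rpow_le_rpow_of_nonpos hY₀ (hn₁.trans hy₁) (by linarith)
  have hlower : Y ^ (γ - 2) / (16 * w ^ 2) ≤ y ^ (γ - 2) :=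
    calc Y ^ (γ - 2) / (16 * w ^ 2) = (4 * w) ^ (-2 : ℝ) * Y ^ (γ - 2) := by
          rw [Real.rpow_neg (by positivity), Real.rpow_two]
          ring
      _ ≤ (4 * w) ^ (γ - 2) * Y ^ (γ - 2) := by
          gcongr <;> linarith
      _ = (4 * w * Y) ^ (γ - 2) := (Real.mul_rpow (by positivity) hY₀.le).symm
      _ ≤ y ^ (γ - 2) :=
          Real.rpow_le_rpow_of_nonpos (by linarith) (by nlinarith) (by linarith)
  rw [hΔ]
  constructor
  · calc _ = γ * (1 - γ) * ξ * w ^ 2 * (Y ^ (γ - 2) / (16 * w ^ 2)) := by field_simp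
      _ ≤ _ := by gcongr
  · calc _ ≤ γ * (1 - γ) * ξ * w ^ 2 * Y ^ (γ - 2) := by gcongr
      _ = _ := by ring

lemma card_le_two_mul_of_mem_Icc {w b Y : ℝ} (hw : 1 ≤ w) (hY : 1 ≤ Y) {s : Finset ℤ}
    (hsY : ∀ n ∈ s, w * n - b ∈ Set.Icc Y (2 * Y)) : (#s : ℝ) ≤ 2 * Y := by
  have hcard := card_le_of_spaced (g := fun n : ℤ ↦ w * n - b) (t := s) (p := Y) (d := Y)
    (by linarith : 0 < w) (by linarith) (fun i _ j _ _ ↦ by linarith)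
    fun n hn ↦ ⟨(hsY n hn).1, by linarith [(hsY n hn).2]⟩
  linarith [div_le_self (by linarith : 0 ≤ Y) hw]

lemma sqrt_mul_mul_rpow_sub_two_div {a ξ γ Y : ℝ} (ha : 0 ≤ a) (hξ : 0 ≤ ξ) (hY : 0 ≤ Y) :
    √(a * ξ * Y ^ (γ - 2) / 16) = √a * √ξ * Y ^ (γ / 2 - 1) / 4 := by
  rw [Real.sqrt_div (by positivity), Real.sqrt_mul (by positivity), Real.sqrt_mul ha,
    Real.sqrt_eq_rpow (Y ^ (γ - 2)), ← Real.rpow_mul hY, show (16 : ℝ) = 4 ^ 2 by norm_num,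
    Real.sqrt_sq (by norm_num)]
  ring_nf

lemma norm_sum_fourierChar_neg_mul_rpow_le {γ w b Y ξ : ℝ} (hγ : γ ∈ Set.Ioo 0 1) (hw : 1 ≤ w)
    (hY : 1 ≤ Y) {s : Finset ℤ} (hs : (s : Set ℤ).OrdConnected)
    (hsY : ∀ n ∈ s, w * n - b ∈ Set.Icc Y (2 * Y)) (hξ : 0 < ξ) (hξY : ξ ≤ Y ^ (1 - γ)) (x : ℝ) :
    ‖∑ n ∈ s, (𝐞 (-ξ * (w * n - b) ^ γ + n * x) : ℂ)‖ ≤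
      32 / √(γ * (1 - γ)) * w ^ 2 * (√ξ * Y ^ (γ / 2) + Y ^ (1 - γ / 2) / √ξ) := by
  have hY₀ : 0 < Y := by linarith
  set κ := γ * (1 - γ)
  have hκ₀ : 0 < κ := mul_pos hγ.1 (sub_pos.2 hγ.2)
  have hκ₁ : κ ≤ 1 := by nlinarith [hγ.1, hγ.2]
  set l := κ * ξ * Y ^ (γ - 2) / 16 with hl
  have hl₀ : 0 < l := by positivity
  have hξ₁ : ξ * Y ^ (γ - 2) ≤ 1 :=
    calc ξ * Y ^ (γ - 2) ≤ Y ^ (1 - γ) * Y ^ (γ - 2) := by gcongr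
      _ = Y ^ (-1 : ℝ) := by rw [← Real.rpow_add hY₀]; ring_nf
      _ ≤ 1 := Real.rpow_le_one_of_one_le_of_nonpos hY (by norm_num)
  have hl₄ : l ≤ 1 / 4 := by
    rw [hl, mul_assoc]
    linarith [mul_le_one₀ hκ₁ (by positivity) hξ₁]
  have hsqrt : √l = √κ * √ξ * Y ^ (γ / 2 - 1) / 4 :=
    sqrt_mul_mul_rpow_sub_two_div hκ₀.le hξ.le hY₀.le
  have hκ : √κ ≤ 1 / √κ := by
    rw [le_div_iff₀ (Real.sqrt_pos.2 hκ₀), Real.mul_self_sqrt hκ₀.le]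
    exact hκ₁
  calc ‖∑ n ∈ s, (𝐞 (-ξ * (w * n - b) ^ γ + n * x) : ℂ)‖
      ≤ (16 * w ^ 2 * l * #s + 2) * (4 / √l) :=
        norm_sum_fourierChar_le_of_fwdDiff_fwdDiff hl₀ hl₄ hs fun n hn ↦
          fwdDiff_fwdDiff_phase_mem_Icc hγ hw hY (hsY n hn) hξ x
    _ ≤ (16 * w ^ 2 * l * (2 * Y) + 2) * (4 / √l) := by
        gcongr
        exact card_le_two_mul_of_mem_Icc hw hY hsY
    _ = 128 * w ^ 2 * Y * √l + 8 / √l := by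
        linear_combination (128 * w ^ 2 * Y) * Real.div_sqrt (x := l)
    _ = 32 * √κ * w ^ 2 * (√ξ * Y ^ (γ / 2)) + 32 * (1 / √κ) * 1 * (Y ^ (1 - γ / 2) / √ξ) := by
        rw [hsqrt, show 1 - γ / 2 = -(γ / 2 - 1) by ring, Real.rpow_neg hY₀.le,
          Real.rpow_sub_one hY₀.ne']
        field_simp
        ring
    _ ≤ 32 * (1 / √κ) * w ^ 2 * (√ξ * Y ^ (γ / 2)) +
          32 * (1 / √κ) * w ^ 2 * (Y ^ (1 - γ / 2) / √ξ) := by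
        gcongr
        exact one_le_pow₀ hw
    _ = _ := by ring

theorem norm_sum_fourierChar_mul_rpow_le {γ w b Y ξ : ℝ} (hγ : γ ∈ Set.Ioo 0 1) (hw : 1 ≤ w)
    (hY : 1 ≤ Y) {s : Finset ℤ} (hs : (s : Set ℤ).OrdConnected)
    (hsY : ∀ n ∈ s, w * n - b ∈ Set.Icc Y (2 * Y)) (hξ : ξ ≠ 0) (hξY : |ξ| ≤ Y ^ (1 - γ))
    (x : ℝ) :
    ‖∑ n ∈ s, (𝐞 (ξ * (w * n - b) ^ γ + n * x) : ℂ)‖ ≤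
      32 / √(γ * (1 - γ)) * w ^ 2 * (√|ξ| * Y ^ (γ / 2) + Y ^ (1 - γ / 2) / √|ξ|) := by
  rcases lt_or_gt_of_ne hξ with h | h
  · rw [abs_of_neg h] at hξY ⊢
    simpa only [neg_neg] using
      norm_sum_fourierChar_neg_mul_rpow_le hγ hw hY hs hsY (neg_pos.2 h) hξY x
  · rw [abs_of_pos h] at hξY ⊢
    rw [← RCLike.norm_conj, map_sum]
    simp only [← fourierChar_neg, neg_add, ← neg_mul]
    simpa only [neg_mul, mul_neg] using
      norm_sum_fourierChar_neg_mul_rpow_le hγ hw hY hs hsY h hξY (-x)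

/-- The Fejér kernel of degree `K`. -/
noncomputable def fejer (K : ℕ) (x : ℝ) : ℝ :=
  ‖∑ h ∈ range (K + 1), (𝐞 (h * x) : ℂ)‖ ^ 2 / (K + 1)

lemma fejer_nonneg (K : ℕ) (x : ℝ) : 0 ≤ fejer K x := by
  rw [fejer]
  positivity

lemma sum_fourierChar_mul_conj (H : ℕ) (x : ℝ) :
    (∑ h ∈ range H, (𝐞 (h * x) : ℂ)) * conj (𝐞 (H * x) : ℂ) =
      ∑ i ∈ range H, (𝐞 (-(i + 1) * x) : ℂ) := by
  rw [sum_mul, ← sum_range_reflect]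
  refine sum_congr rfl fun i hi ↦ ?_
  rw [← fourierChar_neg, ← fourierChar_add, Nat.sub_sub, Nat.cast_sub (by grind)]
  push_cast
  ring_nf

lemma norm_sum_fourierChar_sq (H : ℕ) (x : ℝ) :
    ((‖∑ h ∈ range H, (𝐞 (h * x) : ℂ)‖ ^ 2 : ℝ) : ℂ) =
      H + ∑ h ∈ range H, ∑ i ∈ range h, ((𝐞 ((i + 1) * x) : ℂ) + 𝐞 (-(i + 1) * x)) := by
  induction H with
  | zero => simp
  | succ H ih =>
    have hcross := sum_fourierChar_mul_conj H x
    have hcross' := congrArg conj hcross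
    simp only [map_mul, map_sum, ← fourierChar_neg, neg_mul, neg_neg]
      at hcross hcross'
    have hunit : (𝐞 (H * x) : ℂ) * 𝐞 (-(H * x)) = 1 := by
      rw [← fourierChar_add, add_neg_cancel, AddChar.map_zero_eq_one, Circle.coe_one]
    rw [Complex.ofReal_pow, ← Complex.mul_conj'] at ih ⊢
    rw [sum_range_succ, sum_range_succ, sum_add_distrib]
    simp only [map_add, map_sum, ← fourierChar_neg, neg_mul] at ih ⊢
    push_cast
    linear_combination ih + hcross + hcross' + hunit

lemma fejer_sub_one (K : ℕ) (x : ℝ) :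
    ((fejer K x - 1 : ℝ) : ℂ) = (K + 1 : ℂ)⁻¹ *
      ∑ h ∈ range (K + 1), ∑ i ∈ range h, ((𝐞 ((i + 1) * x) : ℂ) + 𝐞 (-(i + 1) * x)) := by
  have hK : (K + 1 : ℂ) ≠ 0 := by exact_mod_cast K.succ_ne_zero
  rw [fejer, Complex.ofReal_sub, Complex.ofReal_div, norm_sum_fourierChar_sq, add_div]
  push_cast
  rw [div_self hK]
  ring

lemma norm_sum_fejer_sub_one_mul_le {ι : Type*} {s : Finset ι} {φ : ι → ℝ} {z : ι → ℂ} {K : ℕ}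
    {B : ℕ → ℝ} (hpos : ∀ i < K, ‖∑ n ∈ s, (𝐞 ((i + 1) * φ n) : ℂ) * z n‖ ≤ B i)
    (hneg : ∀ i < K, ‖∑ n ∈ s, (𝐞 (-(i + 1) * φ n) : ℂ) * z n‖ ≤ B i) :
    ‖∑ n ∈ s, ((fejer K (φ n) - 1 : ℝ) : ℂ) * z n‖ ≤ 2 * ∑ i ∈ range K, B i := by
  have hexpand : ∑ n ∈ s, ((fejer K (φ n) - 1 : ℝ) : ℂ) * z n = (K + 1 : ℂ)⁻¹ *
      ∑ h ∈ range (K + 1), ∑ i ∈ range h, (∑ n ∈ s, (𝐞 ((i + 1) * φ n) : ℂ) * z n +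
        ∑ n ∈ s, (𝐞 (-(i + 1) * φ n) : ℂ) * z n) := by
    simp_rw [fejer_sub_one, mul_assoc, sum_mul, ← mul_sum, ← sum_add_distrib, ← add_mul]
    congr 1
    rw [sum_comm]
    exact sum_congr rfl fun h _ ↦ sum_comm
  have hrow (h : ℕ) (hh : h ∈ range (K + 1)) :
      ‖∑ i ∈ range h, (∑ n ∈ s, (𝐞 ((i + 1) * φ n) : ℂ) * z n +
        ∑ n ∈ s, (𝐞 (-(i + 1) * φ n) : ℂ) * z n)‖ ≤ 2 * ∑ i ∈ range K, B i := by
    rw [mem_range, Nat.lt_succ_iff] at hh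
    rw [mul_sum]
    refine (norm_sum_le_of_le _ fun i hi ↦ ?_).trans (sum_le_sum_of_subset_of_nonneg
      (range_subset_range.2 hh) fun i hi _ ↦ ?_)
    · have hi : i < K := (mem_range.1 hi).trans_le hh
      rw [two_mul]
      exact (norm_add_le _ _).trans (add_le_add (hpos i hi) (hneg i hi))
    · exact mul_nonneg zero_le_two ((norm_nonneg _).trans (hpos i (mem_range.1 hi)))
  have hK : ‖(K + 1 : ℂ)⁻¹‖ = (K + 1 : ℝ)⁻¹ := by
    rw [norm_inv]
    exact_mod_cast congrArg Inv.inv (Complex.norm_natCast (K + 1))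
  have hrows := (norm_sum_le _ _).trans (sum_le_card_nsmul _ _ _ hrow)
  rw [card_range, nsmul_eq_mul] at hrows
  rw [hexpand, norm_mul, hK, inv_mul_le_iff₀ (by positivity)]
  exact_mod_cast hrows

lemma half_le_re_fourierChar {x : ℝ} (hx : |x| ≤ 1 / 6) : 1 / 2 ≤ (𝐞 x : ℂ).re := by
  have hpi := Real.pi_pos
  rw [Real.fourierChar_apply, Complex.exp_ofReal_mul_I_re, ← Real.cos_pi_div_three,
    ← Real.cos_abs (2 * Real.pi * x)]
  refine Real.cos_le_cos_of_nonneg_of_le_pi (abs_nonneg _) (by linarith) ?_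
  rw [abs_mul, abs_of_pos (by positivity : 0 < 2 * Real.pi)]
  nlinarith

lemma le_fejer {K : ℕ} {x : ℝ} {k : ℤ} (hx : |x - k| * K ≤ 1 / 6) :
    (K + 1 : ℝ) / 4 ≤ fejer K x := by
  have hterm (h : ℕ) (hh : h ∈ range (K + 1)) : 1 / 2 ≤ (𝐞 (h * x) : ℂ).re := by
    have hshift : h * x = h * (x - k) + ((h * k : ℤ) : ℝ) := by
      push_cast
      ring
    rw [hshift, fourierChar_add_intCast]
    refine half_le_re_fourierChar (le_trans ?_ hx)
    rw [abs_mul, Nat.abs_cast, mul_comm]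
    gcongr
    grind
  have hre := card_nsmul_le_sum _ _ _ hterm
  rw [card_range, nsmul_eq_mul, ← Complex.re_sum] at hre
  have hnorm := pow_le_pow_left₀ (by positivity) (hre.trans (Complex.re_le_norm _)) 2
  rw [fejer, le_div_iff₀ (by positivity)]
  push_cast at hnorm
  linarith

lemma sum_range_inv_sqrt_le (n : ℕ) : ∑ i ∈ range n, 1 / √(i + 1) ≤ 2 * √n := by
  induction n with
  | zero => simp
  | succ n ih =>
    have hroot : 0 < √(n + 1 : ℝ) := Real.sqrt_pos.2 (by positivity)
    have hstep : 1 / √(n + 1 : ℝ) ≤ 2 * √(n + 1) - 2 * √n := by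
      rw [div_le_iff₀ hroot]
      nlinarith [sq_nonneg (√(n + 1 : ℝ) - √n), Real.sq_sqrt (n.cast_nonneg : (0 : ℝ) ≤ n),
        Real.sq_sqrt (by positivity : (0 : ℝ) ≤ n + 1)]
    rw [sum_range_succ]
    push_cast
    linarith

lemma sum_range_sqrt_le {γ Y : ℝ} (hY : 0 < Y) {K : ℕ} (hK : K ≤ Y ^ (1 - γ)) :
    ∑ i ∈ range K, (√(i + 1) * Y ^ (γ / 2) + Y ^ (1 - γ / 2) / √(i + 1)) ≤
      3 * Y ^ (3 / 2 - γ) := by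
  have hsqrt : √(K : ℝ) ≤ Y ^ ((1 - γ) / 2) := by
    refine (Real.sqrt_le_sqrt hK).trans_eq ?_
    rw [Real.sqrt_eq_rpow, ← Real.rpow_mul hY.le]
    ring_nf
  have hincr : ∑ i ∈ range K, √(i + 1 : ℝ) ≤ K * √K := by
    have hterm (i : ℕ) (hi : i ∈ range K) : √(i + 1 : ℝ) ≤ √K :=
      Real.sqrt_le_sqrt (by exact_mod_cast mem_range.1 hi)
    simpa only [card_range, nsmul_eq_mul] using sum_le_card_nsmul _ _ _ hterm
  calc _ = (∑ i ∈ range K, √(i + 1 : ℝ)) * Y ^ (γ / 2) +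
        Y ^ (1 - γ / 2) * ∑ i ∈ range K, 1 / √(i + 1) := by
        rw [sum_add_distrib, sum_mul, mul_sum]
        simp only [mul_one_div]
    _ ≤ Y ^ (1 - γ) * Y ^ ((1 - γ) / 2) * Y ^ (γ / 2) +
        Y ^ (1 - γ / 2) * (2 * Y ^ ((1 - γ) / 2)) := by
        gcongr
        · exact hincr.trans (by gcongr)
        · exact (sum_range_inv_sqrt_le K).trans (by gcongr)
    _ = 3 * Y ^ (3 / 2 - γ) := by
        rw [mul_left_comm, ← Real.rpow_add hY, ← Real.rpow_add hY, ← Real.rpow_add hY]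
        ring_nf

theorem norm_sum_fejer_sub_one_le {γ w b Y : ℝ} (hγ : γ ∈ Set.Ioo 0 1) (hw : 1 ≤ w) (hY : 1 ≤ Y)
    {s : Finset ℤ} (hs : (s : Set ℤ).OrdConnected)
    (hsY : ∀ n ∈ s, w * n - b ∈ Set.Icc Y (2 * Y)) {K : ℕ} (hK : K ≤ Y ^ (1 - γ)) (x : ℝ) :
    ‖∑ n ∈ s, ((fejer K ((w * n - b) ^ γ) - 1 : ℝ) : ℂ) * 𝐞 (n * x)‖ ≤
      192 / √(γ * (1 - γ)) * w ^ 2 * Y ^ (3 / 2 - γ) := by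
  have hbound (ε : ℝ) (hε : |ε| = 1) (i : ℕ) (hi : i < K) :
      ‖∑ n ∈ s, (𝐞 (ε * (i + 1) * (w * n - b) ^ γ) : ℂ) * 𝐞 (n * x)‖ ≤
        32 / √(γ * (1 - γ)) * w ^ 2 *
          (√(i + 1) * Y ^ (γ / 2) + Y ^ (1 - γ / 2) / √(i + 1)) := by
    have habs : |ε * (i + 1)| = i + 1 := by
      rw [abs_mul, hε, one_mul, abs_of_pos (by positivity)]
    have hi' : (i + 1 : ℝ) ≤ Y ^ (1 - γ) := le_trans (by exact_mod_cast hi) hK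
    simp only [← fourierChar_add]
    have hsum := norm_sum_fourierChar_mul_rpow_le hγ hw hY hs hsY (ξ := ε * (i + 1))
      (abs_pos.1 (by rw [habs]; positivity)) (by rwa [habs]) x
    rwa [habs] at hsum
  calc _ ≤ 2 * ∑ i ∈ range K, 32 / √(γ * (1 - γ)) * w ^ 2 *
          (√(i + 1) * Y ^ (γ / 2) + Y ^ (1 - γ / 2) / √(i + 1)) :=
        norm_sum_fejer_sub_one_mul_le
          (fun i hi ↦ by simpa only [one_mul] using hbound 1 abs_one i hi)
          fun i hi ↦ by simpa only [neg_one_mul] using hbound (-1) (by simp) i hi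
    _ ≤ 2 * (32 / √(γ * (1 - γ)) * w ^ 2 * (3 * Y ^ (3 / 2 - γ))) := by
        rw [← mul_sum]
        gcongr
        exact sum_range_sqrt_le (by linarith) hK
    _ = _ := by ring

/-! ### The Fejér majorant of the Piatetski-Shapiro weights -/

lemma two_pow_log_floor_mem {m : ℝ} (hm : 1 ≤ m) :
    m ∈ Set.Icc ((2 : ℝ) ^ Nat.log 2 ⌊m⌋₊) (2 * 2 ^ Nat.log 2 ⌊m⌋₊) := by
  have hlow : (2 ^ Nat.log 2 ⌊m⌋₊ : ℕ) ≤ m :=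
    (Nat.cast_le.2 (Nat.pow_log_le_self 2 (Nat.floor_pos.2 hm).ne')).trans
      (Nat.floor_le (zero_le_one.trans hm))
  have hupp : m < (2 ^ (Nat.log 2 ⌊m⌋₊ + 1) : ℕ) :=
    (Nat.floor_lt (zero_le_one.trans hm)).1 (Nat.lt_pow_succ_log_self one_lt_two _)
  push_cast at hlow hupp
  exact ⟨hlow, (hupp.trans_eq (pow_succ' _ _)).le⟩

/-- The degree of the Fejér kernels used on the dyadic block `[2 ^ j, 2 ^ (j + 1)]`. -/
noncomputable def dyadicDegree (γ : ℝ) (j : ℕ) : ℕ := ⌊((2 : ℝ) ^ j) ^ (1 - γ) / 6⌋₊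

lemma dyadicDegree_le (γ : ℝ) (j : ℕ) : (dyadicDegree γ j : ℝ) ≤ ((2 : ℝ) ^ j) ^ (1 - γ) / 6 :=
  Nat.floor_le (by positivity)

/-- A smooth substitute, as a function of the integer `m`, for the indicator of the sequence
`⌊k ^ (1 / γ)⌋` weighted by `m ^ (1 - γ)`: the Fejér kernel at `m ^ γ`, which is large when
`m ^ γ` is close to an integer. -/
noncomputable def fejerMajorant (γ m : ℝ) : ℝ :=
  96 * fejer (dyadicDegree γ (Nat.log 2 ⌊m⌋₊)) (m ^ γ)

lemma abs_rpow_one_div_sub_le {c m : ℝ} {k : ℕ} (hc : 1 < c) (hm : 1 ≤ m)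
    (hk : (k : ℝ) ^ c ∈ Set.Icc m (m + 1)) : |m ^ (1 / c) - k| ≤ m ^ (1 / c - 1) := by
  have hm0 : 0 < m := by linarith
  have hγ : 1 / c ≤ 1 := (div_le_one (by linarith)).2 hc.le
  have hroot : ((k : ℝ) ^ c) ^ (1 / c) = k := by
    rw [one_div, Real.rpow_rpow_inv k.cast_nonneg (by linarith)]
  have hlow : m ^ (1 / c) ≤ k := by
    rw [← hroot]
    gcongr
    exact hk.1
  have hupp : k ≤ m ^ (1 / c) + m ^ (1 / c - 1) := by
    calc (k : ℝ) ≤ (m + 1) ^ (1 / c) := by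
          rw [← hroot]
          gcongr
          exact hk.2
      _ = m ^ (1 / c) * (1 + 1 / m) ^ (1 / c) := by
          rw [← Real.mul_rpow hm0.le (by positivity), mul_one_add, mul_one_div_cancel hm0.ne']
      _ ≤ m ^ (1 / c) * (1 + 1 / c * (1 / m)) := by
          gcongr
          exact rpow_one_add_le_one_add_mul_self (by linarith [one_div_pos.2 hm0])
            (by positivity) hγ
      _ ≤ m ^ (1 / c) * (1 + 1 * (1 / m)) := by gcongr
      _ = m ^ (1 / c) + m ^ (1 / c - 1) := by
          rw [Real.rpow_sub_one hm0.ne']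
          ring
  rw [abs_le]
  constructor <;> linarith [Real.rpow_pos_of_pos hm0 (1 / c - 1)]

lemma two_mul_rpow_le_fejerMajorant {γ m : ℝ} (hγ : γ ∈ Set.Ioo 0 1) (hm : 1 ≤ m) {k : ℤ}
    (hk : |m ^ γ - k| ≤ m ^ (γ - 1)) : 2 * m ^ (1 - γ) ≤ fejerMajorant γ m := by
  obtain ⟨hγ0, hγ1⟩ := hγ
  obtain ⟨hlow, hupp⟩ := two_pow_log_floor_mem hm
  set j := Nat.log 2 ⌊m⌋₊ with hj
  have hY : (0 : ℝ) < 2 ^ j := by positivity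
  have hnear : |m ^ γ - k| * dyadicDegree γ j ≤ 1 / 6 := by
    calc _ ≤ ((2 : ℝ) ^ j) ^ (γ - 1) * (((2 : ℝ) ^ j) ^ (1 - γ) / 6) := by
          gcongr
          · exact hk.trans (Real.rpow_le_rpow_of_nonpos hY hlow (by linarith))
          · exact dyadicDegree_le γ j
      _ = 1 / 6 := by
          rw [← mul_div_assoc, ← Real.rpow_add hY, sub_add_sub_cancel, sub_self, Real.rpow_zero]
  have hdegree : ((2 : ℝ) ^ j) ^ (1 - γ) / 6 < dyadicDegree γ j + 1 := Nat.lt_floor_add_one _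
  have hpow : m ^ (1 - γ) ≤ 2 * ((2 : ℝ) ^ j) ^ (1 - γ) := by
    calc m ^ (1 - γ) ≤ (2 * 2 ^ j) ^ (1 - γ) := by gcongr
      _ = 2 ^ (1 - γ) * ((2 : ℝ) ^ j) ^ (1 - γ) := Real.mul_rpow zero_le_two hY.le
      _ ≤ 2 * ((2 : ℝ) ^ j) ^ (1 - γ) := by
          gcongr
          exact Real.rpow_le_self_of_one_le one_le_two (by linarith)
  have hfejer := le_fejer hnear
  rw [fejerMajorant, ← hj]
  linarith

lemma tau_le_fejerMajorant {c : ℝ} (hc1 : 1 < c) (hc2 : c < 2) {W b : ℕ} {X : ℝ} {n : ℤ}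
    (hn : 1 ≤ (W : ℤ) * n - b) : tau c W b X n ≤ fejerMajorant (1 / c) (W * n - b) := by
  have hγ : 1 / c ∈ Set.Ioo 0 1 := ⟨by positivity, (div_lt_one (by linarith)).2 hc1⟩
  have hm : (1 : ℝ) ≤ W * n - b := by exact_mod_cast hn
  rw [tau]
  split_ifs with h
  · obtain ⟨k, hk⟩ := h.1
    have hfloor := Int.floor_eq_iff.1 hk.symm
    push_cast at hfloor ⊢
    refine le_trans ?_ (two_mul_rpow_le_fejerMajorant hγ hm (k := k) ?_)
    · gcongr
    · exact_mod_cast abs_rpow_one_div_sub_le hc1 hm ⟨hfloor.1, hfloor.2.le⟩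
  · exact mul_nonneg (by norm_num) (fejer_nonneg _ _)

lemma norm_sum_dyadic_le {γ w b : ℝ} (hγ : γ ∈ Set.Ioo 0 1) (hw : 1 ≤ w) {s : Finset ℤ}
    (hs : (s : Set ℤ).OrdConnected) (hs1 : ∀ n ∈ s, 1 ≤ w * n - b) (j : ℕ) (x : ℝ) :
    ‖∑ n ∈ s with Nat.log 2 ⌊w * (n : ℤ) - b⌋₊ = j,
      ((fejer (dyadicDegree γ j) ((w * n - b) ^ γ) - 1 : ℝ) : ℂ) * 𝐞 (n * x)‖ ≤
      192 / √(γ * (1 - γ)) * w ^ 2 * (2 ^ (3 / 2 - γ)) ^ j := by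
  have hmono : Monotone fun n : ℤ ↦ w * n - b := fun i k hik ↦ by
    dsimp only
    gcongr
  have hconn : (({n ∈ s | Nat.log 2 ⌊w * (n : ℤ) - b⌋₊ = j} : Finset ℤ) : Set ℤ).OrdConnected := by
    rw [coe_filter]
    exact ordConnected_filter_mem (I := {y | Nat.log 2 ⌊y⌋₊ = j}) hs (hmono.monotoneOn _)
      (Set.ordConnected_singleton.preimage_mono fun _ _ h ↦
        Nat.log_mono_right (Nat.floor_mono h))
  have hdegree : (dyadicDegree γ j : ℝ) ≤ ((2 : ℝ) ^ j) ^ (1 - γ) :=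
    (dyadicDegree_le γ j).trans (div_le_self (by positivity) (by norm_num))
  refine (norm_sum_fejer_sub_one_le hγ hw (one_le_pow₀ one_le_two) hconn (fun n hn ↦ ?_)
    hdegree x).trans_eq ?_
  · obtain ⟨hns, rfl⟩ := mem_filter.1 hn
    exact two_pow_log_floor_mem (hs1 n hns)
  · rw [← Real.rpow_natCast_mul zero_le_two, mul_comm (j : ℝ), Real.rpow_mul_natCast zero_le_two]

lemma sum_two_rpow_pow_log_le {a X : ℝ} (ha : 0 < a) (hX : 1 ≤ X) :
    ∑ j ∈ range (Nat.log 2 ⌊X⌋₊ + 1), ((2 : ℝ) ^ a) ^ j ≤ 2 ^ a / (2 ^ a - 1) * X ^ a := by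
  have hq : (1 : ℝ) < 2 ^ a := Real.one_lt_rpow one_lt_two ha
  have hlast : ((2 : ℝ) ^ a) ^ Nat.log 2 ⌊X⌋₊ ≤ X ^ a := by
    rw [← Real.rpow_mul_natCast zero_le_two, mul_comm a, Real.rpow_natCast_mul zero_le_two]
    gcongr
    exact (two_pow_log_floor_mem hX).1
  rw [geom_sum_eq hq.ne', pow_succ, div_mul_eq_mul_div]
  gcongr ?_ / _
  nlinarith

theorem norm_sum_fejerMajorant_le {γ w b X : ℝ} (hγ : γ ∈ Set.Ioo 0 1) (hw : 1 ≤ w) (hX : 1 ≤ X)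
    {s : Finset ℤ} (hs : (s : Set ℤ).OrdConnected) (hsX : ∀ n ∈ s, w * n - b ∈ Set.Icc 1 X)
    (x : ℝ) :
    ‖∑ n ∈ s, (fejerMajorant γ (w * n - b) : ℂ) * 𝐞 (n * x)‖ ≤
      96 * ‖∑ n ∈ s, (𝐞 (n * x) : ℂ)‖ + 96 * (192 / √(γ * (1 - γ)) *
        (2 ^ (3 / 2 - γ) / (2 ^ (3 / 2 - γ) - 1))) * w ^ 2 * X ^ (3 / 2 - γ) := by
  set E : ℤ → ℂ := fun n ↦ ((fejer (dyadicDegree γ (Nat.log 2 ⌊w * n - b⌋₊))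
    ((w * n - b) ^ γ) - 1 : ℝ) : ℂ) * 𝐞 (n * x) with hE
  have hsplit : ∑ n ∈ s, (fejerMajorant γ (w * n - b) : ℂ) * 𝐞 (n * x) =
      96 * (∑ n ∈ s, (𝐞 (n * x) : ℂ) + ∑ n ∈ s, E n) := by
    rw [← sum_add_distrib, mul_sum]
    refine sum_congr rfl fun n _ ↦ ?_
    rw [hE, fejerMajorant]
    push_cast
    ring
  have hlevel (n : ℤ) (hn : n ∈ s) :
      Nat.log 2 ⌊w * n - b⌋₊ ∈ range (Nat.log 2 ⌊X⌋₊ + 1) :=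
    mem_range_succ_iff.2 (Nat.log_mono_right (Nat.floor_mono (hsX n hn).2))
  have hblock (j : ℕ) : ‖∑ n ∈ s with Nat.log 2 ⌊w * (n : ℤ) - b⌋₊ = j, E n‖ ≤
      192 / √(γ * (1 - γ)) * w ^ 2 * (2 ^ (3 / 2 - γ)) ^ j := by
    refine le_trans (congrArg norm (sum_congr rfl fun n hn ↦ ?_)).le
      (norm_sum_dyadic_le hγ hw hs (fun n hn ↦ (hsX n hn).1) j x)
    simp only [hE, (mem_filter.1 hn).2]
  have herror : ‖∑ n ∈ s, E n‖ ≤ 192 / √(γ * (1 - γ)) * w ^ 2 *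
      (2 ^ (3 / 2 - γ) / (2 ^ (3 / 2 - γ) - 1) * X ^ (3 / 2 - γ)) := by
    rw [← sum_fiberwise_of_maps_to hlevel]
    refine (norm_sum_le_of_le _ fun j _ ↦ hblock j).trans ?_
    rw [← mul_sum]
    gcongr
    exact sum_two_rpow_pow_log_le (by linarith [hγ.2]) hX
  calc _ ≤ 96 * (‖∑ n ∈ s, (𝐞 (n * x) : ℂ)‖ + ‖∑ n ∈ s, E n‖) := by
        rw [hsplit, norm_mul, Complex.norm_ofNat]
        gcongr
        exact norm_add_le _ _
    _ ≤ _ := by linarith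

/-! ### Young's inequality -/

lemma ennreal_rpow_mul_rpow_mul_rpow {α β γ : ℝ} (hα : α ≤ 1) (hβ : β ≤ 1) (hγ : γ ≤ 1)
    (hαβγ : α + β + γ = 2) (a b c : ENNReal) :
    a ^ α * b ^ β * c ^ γ = (a * b) ^ (1 - γ) * (a * c) ^ (1 - β) * (b * c) ^ (1 - α) := by
  have hadd (x : ENNReal) {p q r : ℝ} (hq : q ≤ 1) (hr : r ≤ 1) (hpqr : p + q + r = 2) :
      x ^ p = x ^ (1 - q) * x ^ (1 - r) := by
    rw [← ENNReal.rpow_add_of_nonneg _ _ (sub_nonneg.2 hq) (sub_nonneg.2 hr)]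
    congr 1
    linarith
  rw [ENNReal.mul_rpow_of_nonneg _ _ (sub_nonneg.2 hα),
    ENNReal.mul_rpow_of_nonneg _ _ (sub_nonneg.2 hβ),
    ENNReal.mul_rpow_of_nonneg _ _ (sub_nonneg.2 hγ), hadd a hγ hβ (by linarith),
    hadd b hγ hα (by linarith), hadd c hβ hα (by linarith)]
  ring

section Young

variable {G : Type*} [AddGroup G] [MeasurableSpace G] [MeasurableAdd₂ G] [MeasurableNeg G]
  {μ : Measure G} [SFinite μ] [μ.IsAddLeftInvariant] [μ.IsAddRightInvariant] [μ.IsNegInvariant]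
  {α β γ : ℝ}

lemma lintegral_mul_mul_sub_le (hα : α ≤ 1) (hβ : β ≤ 1) (hγ : γ ≤ 1) (hαβγ : α + β + γ = 2)
    {f g k : G → ENNReal} (hf : AEMeasurable f μ) (hg : AEMeasurable g μ)
    (hk : AEMeasurable k μ) :
    ∫⁻ z, f z.1 ^ α * g z.2 ^ β * k (z.1 - z.2) ^ γ ∂μ.prod μ ≤
      (∫⁻ x, f x ∂μ) ^ α * (∫⁻ x, g x ∂μ) ^ β * (∫⁻ x, k x ∂μ) ^ γ := by
  have hksub : AEMeasurable (fun z : G × G ↦ k (z.1 - z.2)) (μ.prod μ) :=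
    hk.comp_quasiMeasurePreserving (quasiMeasurePreserving_sub_of_right_invariant μ μ)
  have hfg : ∫⁻ z, f z.1 * g z.2 ∂μ.prod μ = (∫⁻ x, f x ∂μ) * ∫⁻ x, g x ∂μ :=
    lintegral_prod_mul hf hg
  have hfk : ∫⁻ z, f z.1 * k (z.1 - z.2) ∂μ.prod μ = (∫⁻ x, f x ∂μ) * ∫⁻ x, k x ∂μ := by
    rw [lintegral_prod _ (hf.comp_fst.fun_mul hksub), ← lintegral_mul_const'' _ hf]
    refine lintegral_congr fun x ↦ ?_
    rw [← lintegral_sub_left_eq_self k x]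
    exact lintegral_const_mul'' (f x) (hk.comp_quasiMeasurePreserving
      (quasiMeasurePreserving_sub_left_of_right_invariant μ x))
  have hgk : ∫⁻ z, g z.2 * k (z.1 - z.2) ∂μ.prod μ = (∫⁻ x, g x ∂μ) * ∫⁻ x, k x ∂μ := by
    rw [lintegral_prod_symm _ (hg.comp_snd.fun_mul hksub), ← lintegral_mul_const'' _ hg]
    refine lintegral_congr fun y ↦ ?_
    rw [← lintegral_sub_right_eq_self k y]
    exact lintegral_const_mul'' (g y) (hk.comp_quasiMeasurePreserving
      (measurePreserving_sub_right μ y).quasiMeasurePreserving)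
  have hHolder := ENNReal.lintegral_prod_norm_pow_le (μ := μ.prod μ) (univ : Finset (Fin 3))
    (f := ![fun z ↦ f z.1 * g z.2, fun z ↦ f z.1 * k (z.1 - z.2), fun z ↦ g z.2 * k (z.1 - z.2)])
    (p := ![1 - γ, 1 - β, 1 - α])
    (fun i _ ↦ by
      fin_cases i
      exacts [hf.comp_fst.mul hg.comp_snd, hf.comp_fst.mul hksub, hg.comp_snd.mul hksub])
    (by simp only [Fin.sum_univ_three, Matrix.cons_val]; linarith)
    (fun i _ ↦ by fin_cases i <;> simpa)
  simp only [Fin.prod_univ_three, Matrix.cons_val] at hHolder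
  simp only [ennreal_rpow_mul_rpow_mul_rpow hα hβ hγ hαβγ]
  rwa [hfg, hfk, hgk] at hHolder

lemma integral_mul_mul_sub_le (hα : α ∈ Set.Icc 0 1) (hβ : β ∈ Set.Icc 0 1)
    (hγ : γ ∈ Set.Icc 0 1) (hαβγ : α + β + γ = 2) {f g k : G → ℝ} (hf : Integrable f μ)
    (hg : Integrable g μ) (hk : Integrable k μ) (hf0 : 0 ≤ f) (hg0 : 0 ≤ g) (hk0 : 0 ≤ k) :
    ∫ z, f z.1 ^ α * g z.2 ^ β * k (z.1 - z.2) ^ γ ∂μ.prod μ ≤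
      (∫ x, f x ∂μ) ^ α * (∫ x, g x ∂μ) ^ β * (∫ x, k x ∂μ) ^ γ := by
  have htoReal {h : G → ℝ} (hh : Integrable h μ) (hh0 : 0 ≤ h) :
      ∫ x, h x ∂μ = (∫⁻ x, ENNReal.ofReal (h x) ∂μ).toReal :=
    integral_eq_lintegral_of_nonneg_ae (.of_forall hh0) hh.aestronglyMeasurable
  have hmeas : AEStronglyMeasurable (fun z : G × G ↦ f z.1 ^ α * g z.2 ^ β * k (z.1 - z.2) ^ γ)
      (μ.prod μ) :=
    (((hf.aemeasurable.comp_fst.pow_const α).mul (hg.aemeasurable.comp_snd.pow_const β)).mul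
      ((hk.aemeasurable.comp_quasiMeasurePreserving
        (quasiMeasurePreserving_sub_of_right_invariant μ μ)).pow_const γ)).aestronglyMeasurable
  have hofReal (z : G × G) : ENNReal.ofReal (f z.1 ^ α * g z.2 ^ β * k (z.1 - z.2) ^ γ) =
      ENNReal.ofReal (f z.1) ^ α * ENNReal.ofReal (g z.2) ^ β *
        ENNReal.ofReal (k (z.1 - z.2)) ^ γ := by
    rw [ENNReal.ofReal_rpow_of_nonneg (hf0 _) hα.1, ENNReal.ofReal_rpow_of_nonneg (hg0 _) hβ.1,
      ENNReal.ofReal_rpow_of_nonneg (hk0 _) hγ.1,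
      ENNReal.ofReal_mul (mul_nonneg (Real.rpow_nonneg (hf0 _) _) (Real.rpow_nonneg (hg0 _) _)),
      ENNReal.ofReal_mul (Real.rpow_nonneg (hf0 _) _)]
  rw [integral_eq_lintegral_of_nonneg_ae (.of_forall fun z ↦ mul_nonneg
    (mul_nonneg (Real.rpow_nonneg (hf0 _) _) (Real.rpow_nonneg (hg0 _) _))
    (Real.rpow_nonneg (hk0 _) _)) hmeas, htoReal hf hf0, htoReal hg hg0, htoReal hk hk0]
  simp only [ENNReal.toReal_rpow, ← ENNReal.toReal_mul, hofReal]
  exact ENNReal.toReal_mono (ENNReal.mul_ne_top (ENNReal.mul_ne_top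
    (ENNReal.rpow_ne_top_of_nonneg hα.1 hf.lintegral_lt_top.ne)
    (ENNReal.rpow_ne_top_of_nonneg hβ.1 hg.lintegral_lt_top.ne))
    (ENNReal.rpow_ne_top_of_nonneg hγ.1 hk.lintegral_lt_top.ne))
    (lintegral_mul_mul_sub_le hα.2 hβ.2 hγ.2 hαβγ hf.aemeasurable.ennreal_ofReal
      hg.aemeasurable.ennreal_ofReal hk.aemeasurable.ennreal_ofReal)

end Young

/-! ### The restriction estimate -/

/-- The trigonometric polynomial with coefficients `f` and frequencies in `s`. -/
noncomputable def trigPoly (s : Finset ℤ) (f : ℤ → ℂ) : C(UnitAddCircle, ℂ) :=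
  ∑ n ∈ s, f n • fourier n

lemma trigPoly_apply (s : Finset ℤ) (f : ℤ → ℂ) (x : UnitAddCircle) :
    trigPoly s f x = ∑ n ∈ s, f n * fourier n x := by
  simp only [trigPoly, ContinuousMap.sum_apply, ContinuousMap.smul_apply, smul_eq_mul]

lemma norm_fourier_apply (n : ℤ) (x : UnitAddCircle) : ‖fourier n x‖ = 1 := by
  rw [fourier_apply, Circle.norm_coe]

lemma fourier_apply_sub (n : ℤ) (x y : UnitAddCircle) :
    fourier n (x - y) = fourier n x * conj (fourier n y) := by
  simp only [fourier_apply, sub_eq_add_neg, smul_add, smul_neg, AddCircle.toCircle_add,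
    AddCircle.toCircle_neg, Circle.coe_mul, Circle.coe_inv_eq_conj]

lemma integral_norm_trigPoly_sq (s : Finset ℤ) (f : ℤ → ℂ) :
    ∫ x, ‖trigPoly s f x‖ ^ 2 = ∑ n ∈ s, ‖f n‖ ^ 2 := by
  have hLp : ContinuousMap.toLp (E := ℂ) 2 AddCircle.haarAddCircle ℂ (trigPoly s f) =
      ∑ n ∈ s, f n • fourierLp 2 n := by
    simp only [trigPoly, map_sum, map_smul, fourierLp]
  have hinner := (orthonormal_fourier (T := 1)).inner_sum f f s
  rw [← hLp, ContinuousMap.inner_toLp, AddCircle.integral_haarAddCircle, inv_one, one_smul]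
    at hinner
  simp only [Complex.mul_conj', Complex.conj_mul'] at hinner
  exact_mod_cast hinner

lemma integrable_mul_mul_sub {𝕜 : Type*} [RCLike 𝕜] {f g : UnitAddCircle → 𝕜}
    (hf : Integrable f) (hg : Integrable g) (k : C(UnitAddCircle, 𝕜)) :
    Integrable fun z : UnitAddCircle × UnitAddCircle ↦ f z.1 * g z.2 * k (z.1 - z.2) :=
  (hf.mul_prod hg).mul_bdd (k.continuous.comp continuous_sub).aestronglyMeasurable
    (.of_forall fun _ ↦ k.norm_coe_le_norm _)

section TTStar

variable {s : Finset ℤ} {f : ℤ → ℂ} {ν : ℤ → ℝ} {g : UnitAddCircle → ℂ}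

lemma integral_trigPoly_mul (hg : Integrable g) :
    ∫ x, trigPoly s f x * g x = ∑ n ∈ s, f n * ∫ x, fourier n x * g x := by
  simp only [trigPoly_apply, sum_mul, mul_assoc]
  rw [integral_finsetSum _ fun n _ ↦ ?_]
  · simp only [integral_const_mul]
  · exact (hg.bdd_mul (fourier n).continuous.aestronglyMeasurable
      (.of_forall fun x ↦ (norm_fourier_apply n x).le)).const_mul _

lemma sum_mul_norm_integral_fourier_mul_sq_le (hg : Integrable g) :
    ∑ n ∈ s, ν n * ‖∫ x, fourier n x * g x‖ ^ 2 ≤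
      ∫ z : UnitAddCircle × UnitAddCircle,
        ‖g z.1‖ * ‖g z.2‖ * ‖trigPoly s (fun n ↦ ν n) (z.1 - z.2)‖ := by
  have hconj : Integrable fun x ↦ conj (g x) :=
    hg.mono (Complex.continuous_conj.comp_aestronglyMeasurable hg.aestronglyMeasurable)
      (.of_forall fun x ↦ (RCLike.norm_conj (g x)).le)
  have hterm (n : ℤ) : ((‖∫ x, fourier n x * g x‖ ^ 2 : ℝ) : ℂ) =
      ∫ z : UnitAddCircle × UnitAddCircle, g z.1 * conj (g z.2) * fourier n (z.1 - z.2) := by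
    rw [Complex.ofReal_pow, ← Complex.mul_conj', ← integral_conj, ← integral_prod_mul]
    refine integral_congr_ae (.of_forall fun z ↦ ?_)
    simp only [fourier_apply_sub, map_mul]
    ring
  have hsum : ((∑ n ∈ s, ν n * ‖∫ x, fourier n x * g x‖ ^ 2 : ℝ) : ℂ) =
      ∫ z : UnitAddCircle × UnitAddCircle,
        g z.1 * conj (g z.2) * trigPoly s (fun n ↦ ν n) (z.1 - z.2) := by
    simp only [trigPoly_apply, mul_sum, mul_left_comm _ (Complex.ofReal _)]
    rw [integral_finsetSum _ fun n _ ↦ (integrable_mul_mul_sub hg hconj _).const_mul _]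
    simp only [integral_const_mul, ← hterm, Complex.ofReal_sum, Complex.ofReal_mul]
  refine (le_abs_self _).trans ?_
  rw [← Real.norm_eq_abs, ← Complex.norm_real, hsum]
  refine (norm_integral_le_integral_norm _).trans_eq ?_
  simp only [norm_mul, RCLike.norm_conj]

lemma norm_integral_trigPoly_mul_sq_le {k : C(UnitAddCircle, ℝ)} {M D : ℝ}
    (hf : ∀ n ∈ s, ‖f n‖ ≤ ν n) (hν : ∀ x, ‖trigPoly s (fun n ↦ ν n) x‖ ≤ k x + D)
    (hM : ∑ n ∈ s, ν n ≤ M) (hg : Integrable g) :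
    ‖∫ x, trigPoly s f x * g x‖ ^ 2 ≤
      M * ((∫ z : UnitAddCircle × UnitAddCircle, ‖g z.1‖ * ‖g z.2‖ * k (z.1 - z.2)) +
        D * (∫ x, ‖g x‖) ^ 2) := by
  have hν0 : ∀ n ∈ s, 0 ≤ ν n := fun n hn ↦ (norm_nonneg _).trans (hf n hn)
  have hν0' : ∀ n ∈ s, 0 ≤ ν n * ‖∫ x, fourier n x * g x‖ ^ 2 :=
    fun n hn ↦ mul_nonneg (hν0 n hn) (sq_nonneg _)
  have hdual : ‖∫ x, trigPoly s f x * g x‖ ≤ ∑ n ∈ s, ν n * ‖∫ x, fourier n x * g x‖ := by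
    rw [integral_trigPoly_mul hg]
    refine norm_sum_le_of_le s fun n hn ↦ ?_
    rw [norm_mul]
    exact mul_le_mul_of_nonneg_right (hf n hn) (norm_nonneg _)
  have hcauchy : (∑ n ∈ s, ν n * ‖∫ x, fourier n x * g x‖) ^ 2 ≤
      (∑ n ∈ s, ν n) * ∑ n ∈ s, ν n * ‖∫ x, fourier n x * g x‖ ^ 2 :=
    sum_sq_le_sum_mul_sum_of_sq_le_mul s hν0 hν0' fun n _ ↦ by apply le_of_eq; ring
  have hnorm := integrable_mul_mul_sub hg.norm hg.norm
  have hkernel : ∑ n ∈ s, ν n * ‖∫ x, fourier n x * g x‖ ^ 2 ≤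
      (∫ z : UnitAddCircle × UnitAddCircle, ‖g z.1‖ * ‖g z.2‖ * k (z.1 - z.2)) +
        D * (∫ x, ‖g x‖) ^ 2 := by
    refine (sum_mul_norm_integral_fourier_mul_sq_le hg).trans ?_
    rw [sq (∫ x, ‖g x‖), ← integral_prod_mul, ← integral_const_mul,
      ← Measure.volume_eq_prod, ← integral_add (hnorm k) ((hg.norm.mul_prod hg.norm).const_mul D)]
    refine integral_mono
      (hnorm ⟨fun x ↦ ‖trigPoly s (fun n ↦ ν n) x‖, by fun_prop⟩)
      ((hnorm k).add ((hg.norm.mul_prod hg.norm).const_mul D)) fun z ↦ ?_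
    calc ‖g z.1‖ * ‖g z.2‖ * ‖trigPoly s (fun n ↦ ν n) (z.1 - z.2)‖
        ≤ ‖g z.1‖ * ‖g z.2‖ * (k (z.1 - z.2) + D) := by gcongr; exact hν _
      _ = ‖g z.1‖ * ‖g z.2‖ * k (z.1 - z.2) + D * (‖g z.1‖ * ‖g z.2‖) := by ring
  calc ‖∫ x, trigPoly s f x * g x‖ ^ 2
      ≤ (∑ n ∈ s, ν n * ‖∫ x, fourier n x * g x‖) ^ 2 := by gcongr
    _ ≤ (∑ n ∈ s, ν n) * ∑ n ∈ s, ν n * ‖∫ x, fourier n x * g x‖ ^ 2 := hcauchy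
    _ ≤ _ := mul_le_mul hM hkernel (sum_nonneg hν0') ((sum_nonneg hν0).trans hM)

end TTStar

section LevelSet

variable {B u : ℝ}

/-- `‖z‖ ^ u`, truncated to large values. -/
noncomputable def tailPow (B u : ℝ) (z : ℂ) : ℝ :=
  if B < ‖z‖ then ‖z‖ ^ u else 0

/-- The dual factor of `tailPow`: pairing a function `F` with `tailDual B u ∘ F` yields
`∫ tailPow B u (F x)`. -/
noncomputable def tailDual (B u : ℝ) (z : ℂ) : ℂ :=
  if B < ‖z‖ then (‖z‖ ^ (u - 2) : ℝ) * conj z else 0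

lemma measurable_tailPow : Measurable (tailPow B u) :=
  Measurable.ite (measurableSet_lt measurable_const measurable_norm)
    (measurable_norm.pow_const u) measurable_const

lemma measurable_tailDual : Measurable (tailDual B u) :=
  Measurable.ite (measurableSet_lt measurable_const measurable_norm)
    ((Complex.measurable_ofReal.comp (measurable_norm.pow_const _)).mul
      Complex.continuous_conj.measurable) measurable_const

lemma tailPow_nonneg (z : ℂ) : 0 ≤ tailPow B u z := by
  unfold tailPow
  positivity

lemma tailPow_le (z : ℂ) : tailPow B u z ≤ ‖z‖ ^ u := by
  unfold tailPow
  split_ifs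
  exacts [le_rfl, by positivity]

lemma mul_tailDual (hB : 0 ≤ B) (z : ℂ) : z * tailDual B u z = tailPow B u z := by
  unfold tailDual tailPow
  split_ifs with hz
  · rw [mul_left_comm, Complex.mul_conj', ← Complex.ofReal_pow, ← Complex.ofReal_mul,
      ← Real.rpow_add_natCast (hB.trans_lt hz).ne']
    norm_num
  · rw [mul_zero, Complex.ofReal_zero]

lemma mul_norm_tailDual_le (hB : 0 ≤ B) (z : ℂ) : B * ‖tailDual B u z‖ ≤ tailPow B u z := by
  by_cases hz : B < ‖z‖
  · calc B * ‖tailDual B u z‖ ≤ ‖z‖ * ‖tailDual B u z‖ := by gcongr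
      _ = tailPow B u z := by
        rw [← norm_mul, mul_tailDual hB, Complex.norm_of_nonneg (tailPow_nonneg z)]
  · simp only [tailDual, tailPow, if_neg hz, norm_zero, mul_zero, le_refl]

lemma norm_tailDual (hB : 0 ≤ B) (hu : 1 < u) (z : ℂ) :
    ‖tailDual B u z‖ = tailPow B u z ^ ((u - 1) / u) := by
  unfold tailDual tailPow
  split_ifs with hz
  · rw [norm_mul, RCLike.norm_conj, Complex.norm_of_nonneg (by positivity),
      ← Real.rpow_add_one (hB.trans_lt hz).ne', ← Real.rpow_mul (norm_nonneg z),
      mul_div_cancel₀ _ (by positivity)]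
    ring_nf
  · rw [norm_zero, Real.zero_rpow (div_pos (sub_pos.2 hu) (by positivity)).ne']

lemma norm_rpow_le_tailPow_add (hB : 0 ≤ B) (hu : 2 ≤ u) (z : ℂ) :
    ‖z‖ ^ u ≤ tailPow B u z + B ^ (u - 2) * ‖z‖ ^ 2 := by
  unfold tailPow
  split_ifs with hz
  · exact le_add_of_nonneg_right (by positivity)
  · rw [zero_add]
    calc ‖z‖ ^ u = ‖z‖ ^ (u - 2) * ‖z‖ ^ 2 := by
          rw [← Real.rpow_natCast, ← Real.rpow_add_of_nonneg (norm_nonneg z) (sub_nonneg.2 hu)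
            (Nat.cast_nonneg _)]
          norm_num
      _ ≤ B ^ (u - 2) * ‖z‖ ^ 2 := by
          gcongr
          exact not_lt.1 hz

lemma integrable_tailPow_comp (hu : 0 ≤ u) (F : C(UnitAddCircle, ℂ)) :
    Integrable fun x ↦ tailPow B u (F x) :=
  .of_bound (measurable_tailPow.comp F.continuous.measurable).aestronglyMeasurable (‖F‖ ^ u)
    (.of_forall fun x ↦ by
      rw [Real.norm_of_nonneg (tailPow_nonneg _)]
      exact (tailPow_le _).trans (by gcongr; exact F.norm_coe_le_norm x))

lemma integrable_tailDual_comp (hB : 0 ≤ B) (hu : 1 < u) (F : C(UnitAddCircle, ℂ)) :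
    Integrable fun x ↦ tailDual B u (F x) :=
  .of_bound (measurable_tailDual.comp F.continuous.measurable).aestronglyMeasurable
    ((‖F‖ ^ u) ^ ((u - 1) / u)) (.of_forall fun x ↦ by
      rw [norm_tailDual hB hu]
      have : 0 ≤ (u - 1) / u := div_nonneg (by linarith) (by linarith)
      gcongr
      · exact tailPow_nonneg _
      · exact (tailPow_le _).trans (by gcongr; exact F.norm_coe_le_norm x))

lemma le_rpow_mul_of_sq_le {I C K : ℝ} (hu : 0 < u) (hI : 0 ≤ I) (hC : 0 ≤ C) (hK : 0 ≤ K)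
    (h : I ^ 2 ≤ C * (I ^ ((u - 1) / u) * I ^ ((u - 1) / u) * K ^ (2 / u))) :
    I ≤ C ^ (u / 2) * K := by
  rcases hI.eq_or_lt with rfl | hI
  · positivity
  have hsplit : I ^ 2 = I ^ (2 / u) * (I ^ ((u - 1) / u) * I ^ ((u - 1) / u)) := by
    rw [← Real.rpow_add hI, ← Real.rpow_add hI, ← Real.rpow_natCast]
    congr 1
    field_simp
    push_cast
    ring
  have hroot : I ^ (2 / u) ≤ C * K ^ (2 / u) := by
    refine le_of_mul_le_mul_right ?_
      (show 0 < I ^ ((u - 1) / u) * I ^ ((u - 1) / u) by positivity)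
    rw [← hsplit]
    linarith
  have hexp : 2 / u * (u / 2) = 1 := by field_simp
  calc I = (I ^ (2 / u)) ^ (u / 2) := by rw [← Real.rpow_mul hI.le, hexp, Real.rpow_one]
    _ ≤ (C * K ^ (2 / u)) ^ (u / 2) := by gcongr
    _ = C ^ (u / 2) * K := by
      rw [Real.mul_rpow hC (by positivity), ← Real.rpow_mul hK, hexp, Real.rpow_one]

lemma integrable_rpow_comp (hu : 0 ≤ u) (k : C(UnitAddCircle, ℝ)) :
    Integrable fun x ↦ k x ^ u :=
  (k.continuous.rpow_const fun _ ↦ .inr hu).integrable_of_hasCompactSupport (.of_compactSpace _)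

lemma integral_norm_tailDual_mul_norm_tailDual_mul_le (hB : 0 ≤ B) (hu : 2 ≤ u)
    (F : C(UnitAddCircle, ℂ)) {k : C(UnitAddCircle, ℝ)} (hk : ∀ x, 0 ≤ k x) :
    ∫ z : UnitAddCircle × UnitAddCircle,
        ‖tailDual B u (F z.1)‖ * ‖tailDual B u (F z.2)‖ * k (z.1 - z.2) ≤
      (∫ x, tailPow B u (F x)) ^ ((u - 1) / u) * (∫ x, tailPow B u (F x)) ^ ((u - 1) / u) *
        (∫ x, k x ^ (u / 2)) ^ (2 / u) := by
  have hu0 : 0 < u := by linarith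
  have hexp : (u - 1) / u ∈ Set.Icc 0 1 :=
    ⟨div_nonneg (by linarith) hu0.le, (div_le_one hu0).2 (by linarith)⟩
  have hkpow (x : UnitAddCircle) : (k x ^ (u / 2)) ^ (2 / u) = k x := by
    rw [← Real.rpow_mul (hk x), div_mul_div_cancel₀ two_ne_zero, div_self hu0.ne', Real.rpow_one]
  have hint := integrable_tailPow_comp (B := B) hu0.le F
  have hYoung := integral_mul_mul_sub_le (α := (u - 1) / u) (β := (u - 1) / u) (γ := 2 / u) hexp
    hexp ⟨by positivity, (div_le_one hu0).2 hu⟩ (by field_simp; ring) hint hint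
    (integrable_rpow_comp (u := u / 2) (by positivity) k) (fun _ ↦ tailPow_nonneg _)
    (fun _ ↦ tailPow_nonneg _) fun x ↦ Real.rpow_nonneg (hk x) _
  simpa only [norm_tailDual hB (one_lt_two.trans_le hu), hkpow, Measure.volume_eq_prod]
    using hYoung

end LevelSet

section Restriction

variable {s : Finset ℤ} {f : ℤ → ℂ} {ν : ℤ → ℝ} {k : C(UnitAddCircle, ℝ)} {M D u : ℝ}

/-- Above the height `√(2MD)` the constant part `D` of the majorant is absorbed, and only the
kernel `k` contributes. -/
lemma integral_tailPow_trigPoly_le (hu : 2 ≤ u) (hf : ∀ n ∈ s, ‖f n‖ ≤ ν n)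
    (hν : ∀ x, ‖trigPoly s (fun n ↦ ν n) x‖ ≤ k x + D) (hM : ∑ n ∈ s, ν n ≤ M) (hD : 0 ≤ D)
    (hk : ∀ x, 0 ≤ k x) :
    ∫ x, tailPow √(2 * M * D) u (trigPoly s f x) ≤
      (2 * M) ^ (u / 2) * ∫ x, k x ^ (u / 2) := by
  have hM0 : 0 ≤ M := (sum_nonneg fun n hn ↦ (norm_nonneg _).trans (hf n hn)).trans hM
  set B := √(2 * M * D)
  have hB : 0 ≤ B := Real.sqrt_nonneg _
  set F := trigPoly s f
  have hh0 : 0 ≤ ∫ x, tailPow B u (F x) := integral_nonneg fun x ↦ tailPow_nonneg _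
  have hg := integrable_tailDual_comp hB (one_lt_two.trans_le hu) F
  have hduality : (∫ x, tailPow B u (F x)) ^ 2 ≤ M * ((∫ z : UnitAddCircle × UnitAddCircle,
      ‖tailDual B u (F z.1)‖ * ‖tailDual B u (F z.2)‖ * k (z.1 - z.2)) +
        D * (∫ x, ‖tailDual B u (F x)‖) ^ 2) := by
    have := norm_integral_trigPoly_mul_sq_le hf hν hM hg
    simpa only [F, mul_tailDual hB, integral_complex_ofReal, Complex.norm_of_nonneg hh0] using this
  have hlevel : 2 * M * D * (∫ x, ‖tailDual B u (F x)‖) ^ 2 ≤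
      (∫ x, tailPow B u (F x)) ^ 2 := by
    rw [← Real.sq_sqrt (show 0 ≤ 2 * M * D by positivity), ← mul_pow, ← integral_const_mul]
    exact pow_le_pow_left₀ (integral_nonneg fun x ↦ by positivity)
      (integral_mono (hg.norm.const_mul _) (integrable_tailPow_comp (by linarith) F)
        fun x ↦ mul_norm_tailDual_le hB _) 2
  refine le_rpow_mul_of_sq_le (by linarith) hh0 (by positivity)
    (integral_nonneg fun x ↦ Real.rpow_nonneg (hk x) _) ?_
  have hYoung := mul_le_mul_of_nonneg_left
    (integral_norm_tailDual_mul_norm_tailDual_mul_le hB hu F hk) (show 0 ≤ 2 * M by positivity)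
  linarith

theorem integral_norm_trigPoly_rpow_le (hu : 2 ≤ u) (hf : ∀ n ∈ s, ‖f n‖ ≤ ν n)
    (hν : ∀ x, ‖trigPoly s (fun n ↦ ν n) x‖ ≤ k x + D) (hM : ∑ n ∈ s, ν n ≤ M) (hD : 0 ≤ D)
    (hk : ∀ x, 0 ≤ k x) :
    ∫ x, ‖trigPoly s f x‖ ^ u ≤ (2 * M) ^ (u / 2) * (∫ x, k x ^ (u / 2)) +
      (2 * M * D) ^ ((u - 2) / 2) * ∑ n ∈ s, ‖f n‖ ^ 2 := by
  have hM0 : 0 ≤ M := (sum_nonneg fun n hn ↦ (norm_nonneg _).trans (hf n hn)).trans hM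
  have hB : √(2 * M * D) ^ (u - 2) = (2 * M * D) ^ ((u - 2) / 2) := by
    rw [Real.sqrt_eq_rpow, ← Real.rpow_mul (by positivity)]
    ring_nf
  have hnorm (v : ℝ) (hv : 0 ≤ v) : Integrable fun x ↦ ‖trigPoly s f x‖ ^ v :=
    integrable_rpow_comp hv ⟨fun x ↦ ‖trigPoly s f x‖, by fun_prop⟩
  have hsq : Integrable fun x ↦ ‖trigPoly s f x‖ ^ 2 := by
    simpa only [Real.rpow_two] using hnorm 2 zero_le_two
  have htail := integrable_tailPow_comp (B := √(2 * M * D)) (u := u) (by linarith) (trigPoly s f)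
  have hsplit := integral_mono (hnorm u (by linarith)) (htail.add (hsq.const_mul _)) fun x ↦
    norm_rpow_le_tailPow_add (Real.sqrt_nonneg (2 * M * D)) hu (trigPoly s f x)
  rw [integral_add' htail (hsq.const_mul _), integral_const_mul, integral_norm_trigPoly_sq, hB]
    at hsplit
  exact hsplit.trans (by gcongr; exact integral_tailPow_trigPoly_le hu hf hν hM hD hk)

end Restriction

/-! ### The Dirichlet kernel -/

lemma fourier_coe_eq_fourierChar (n : ℤ) (x : ℝ) :
    fourier n (x : UnitAddCircle) = (𝐞 (n * x) : ℂ) := by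
  rw [fourier_coe_apply, Real.fourierChar_apply]
  push_cast
  ring_nf

/-- A smooth form of `min (P, 1 / ‖x‖)`, which up to a constant majorizes the Dirichlet kernel of an
interval of at most `P` integers. -/
noncomputable def dirichletMajorant (P : ℕ) : C(UnitAddCircle, ℝ) where
  toFun x := 2 * P / (1 + P * ‖x‖)
  continuous_toFun := by
    refine Continuous.div (by fun_prop) (by fun_prop) fun x ↦ ?_
    positivity

lemma dirichletMajorant_apply (P : ℕ) (x : UnitAddCircle) :
    dirichletMajorant P x = 2 * P / (1 + P * ‖x‖) := rfl

lemma dirichletMajorant_nonneg (P : ℕ) (x : UnitAddCircle) : 0 ≤ dirichletMajorant P x := by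
  rw [dirichletMajorant_apply]
  positivity

lemma norm_sum_fourierChar_mul_mul_norm_le {s : Finset ℤ} (hs : (s : Set ℤ).OrdConnected) (x : ℝ) :
    ‖∑ n ∈ s, (𝐞 (n * x) : ℂ)‖ * ‖(x : UnitAddCircle)‖ ≤ 1 := by
  rcases (norm_nonneg (x : UnitAddCircle)).eq_or_lt with h0 | h0
  · rw [← h0, mul_zero]
    exact zero_le_one
  have hdiff (i : ℤ) : Δ_[1] (fun n : ℤ ↦ (n * x : ℝ)) i = x := by
    rw [fwdDiff]
    push_cast
    ring
  rw [← le_div_iff₀ h0]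
  refine norm_sum_fourierChar_le_of_fwdDiff (v := ⌊x⌋) h0 hs (fun i _ j _ _ ↦ ?_) fun i _ ↦ ?_
  · rw [hdiff, hdiff]
  · rw [hdiff, Int.self_sub_floor, UnitAddCircle.norm_eq, abs_sub_round_eq_min]
    exact ⟨min_le_left _ _, le_sub_comm.1 (min_le_right _ _)⟩

theorem norm_sum_fourierChar_mul_le_dirichletMajorant {s : Finset ℤ}
    (hs : (s : Set ℤ).OrdConnected) {P : ℕ} (hP : #s ≤ P) (x : ℝ) :
    ‖∑ n ∈ s, (𝐞 (n * x) : ℂ)‖ ≤ dirichletMajorant P x := by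
  have htriv : ‖∑ n ∈ s, (𝐞 (n * x) : ℂ)‖ ≤ P := by
    refine (norm_sum_le _ _).trans ?_
    simpa only [Circle.norm_coe, sum_const, nsmul_one, Nat.cast_le] using hP
  have hdecay := norm_sum_fourierChar_mul_mul_norm_le hs x
  rw [dirichletMajorant_apply, le_div_iff₀ (by positivity)]
  nlinarith [mul_le_mul_of_nonneg_left hdecay (Nat.cast_nonneg (α := ℝ) P)]

lemma integral_dirichletMajorant_rpow_le {P : ℕ} (hP : 0 < P) {β : ℝ} (hβ : 1 < β) :
    ∫ x, dirichletMajorant P x ^ β ≤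
      2 ^ β * (∫ x : ℝ, (1 + ‖x‖) ^ (-β)) * (P : ℝ) ^ (β - 1) := by
  have hP' : (0 : ℝ) < P := mod_cast hP
  have hint : Integrable fun x : ℝ ↦ (1 + ‖P * x‖) ^ (-β) := by
    refine Integrable.comp_mul_left' (integrable_one_add_norm ?_) hP'.ne'
    simpa using hβ
  have hpoint : ∀ x ∈ Set.Ioc (-1 / 2) (-1 / 2 + 1 : ℝ),
      dirichletMajorant P x ^ β = (2 * P) ^ β * (1 + ‖P * x‖) ^ (-β) := by
    rintro x ⟨h₁, h₂⟩
    have hx : ‖(x : UnitAddCircle)‖ = |x| := by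
      rw [AddCircle.norm_coe_eq_abs_iff 1 one_ne_zero, abs_one, abs_le]
      constructor <;> linarith
    rw [dirichletMajorant_apply, hx, Real.div_rpow (by positivity) (by positivity),
      Real.rpow_neg (by positivity), ← div_eq_mul_inv, norm_mul, Real.norm_natCast,
      Real.norm_eq_abs]
  calc ∫ x, dirichletMajorant P x ^ β
      = ∫ x in Set.Ioc (-1 / 2) (-1 / 2 + 1 : ℝ), (2 * P) ^ β * (1 + ‖P * x‖) ^ (-β) := by
        rw [← UnitAddCircle.integral_preimage (-1 / 2)]
        exact setIntegral_congr_fun measurableSet_Ioc hpoint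
    _ ≤ ∫ x : ℝ, (2 * P) ^ β * (1 + ‖P * x‖) ^ (-β) :=
        setIntegral_le_integral (hint.const_mul _) (.of_forall fun x ↦ by positivity)
    _ = 2 ^ β * (∫ x : ℝ, (1 + ‖x‖) ^ (-β)) * (P : ℝ) ^ (β - 1) := by
        rw [integral_const_mul, Measure.integral_comp_mul_left (fun x : ℝ ↦ (1 + ‖x‖) ^ (-β)),
          Real.mul_rpow zero_le_two hP'.le, Real.rpow_sub_one hP'.ne', abs_inv,
          abs_of_pos hP', smul_eq_mul]
        ring

section DirichletMajorant

variable {s : Finset ℤ} {f : ℤ → ℂ} {ν : ℤ → ℝ} {N : ℕ} {a b D T u : ℝ}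

lemma sum_le_of_norm_trigPoly_le
    (hν : ∀ x, ‖trigPoly s (fun n ↦ ν n) x‖ ≤ a * dirichletMajorant N x + D) :
    ∑ n ∈ s, ν n ≤ 2 * a * N + D := by
  have h0 : trigPoly s (fun n ↦ ν n) 0 = (∑ n ∈ s, ν n : ℝ) := by
    simp only [trigPoly_apply, fourier_eval_zero, mul_one, Complex.ofReal_sum]
  have h := hν 0
  rw [h0, Complex.norm_real, dirichletMajorant_apply, norm_zero] at h
  calc ∑ n ∈ s, ν n ≤ ‖∑ n ∈ s, ν n‖ := Real.le_norm_self _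
    _ ≤ a * (2 * N / (1 + N * 0)) + D := h
    _ = 2 * a * N + D := by ring

lemma sum_norm_sq_le {M : ℝ} (hf : ∀ n ∈ s, ‖f n‖ ≤ ν n) (hfT : ∀ n ∈ s, ‖f n‖ ≤ T) (hT : 0 ≤ T)
    (hM : ∑ n ∈ s, ν n ≤ M) : ∑ n ∈ s, ‖f n‖ ^ 2 ≤ T * M := by
  calc ∑ n ∈ s, ‖f n‖ ^ 2 ≤ ∑ n ∈ s, T * ν n := sum_le_sum fun n hn ↦ by
        rw [sq]
        exact mul_le_mul (hfT n hn) (hf n hn) (norm_nonneg _) hT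
    _ ≤ T * M := by
        rw [← mul_sum]
        exact mul_le_mul_of_nonneg_left hM hT

lemma integral_mul_dirichletMajorant_rpow_le (ha : 0 ≤ a) (hN : 0 < N) (hu : 2 < u) :
    ∫ x, (a * dirichletMajorant N x) ^ (u / 2) ≤
      (2 * a) ^ (u / 2) * (∫ x : ℝ, (1 + ‖x‖) ^ (-(u / 2))) * (N : ℝ) ^ (u / 2 - 1) := by
  have hsplit (x : UnitAddCircle) : (a * dirichletMajorant N x) ^ (u / 2) =
      a ^ (u / 2) * dirichletMajorant N x ^ (u / 2) :=
    Real.mul_rpow ha (dirichletMajorant_nonneg N x)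
  have hint := mul_le_mul_of_nonneg_left
    (integral_dirichletMajorant_rpow_le hN (show 1 < u / 2 by linarith))
    (Real.rpow_nonneg ha (u / 2))
  simp_rw [hsplit]
  rw [integral_const_mul, Real.mul_rpow zero_le_two ha]
  linarith

lemma mul_rpow_half_mul_rpow {x P : ℝ} (hx : 0 ≤ x) (hP : 0 < P) :
    (x * P) ^ (u / 2) * P ^ (u / 2 - 1) = x ^ (u / 2) * P ^ (u - 1) := by
  rw [Real.mul_rpow hx hP.le, mul_assoc, ← Real.rpow_add hP]
  ring_nf

lemma mul_sq_mul_rpow_mul_mul {x P : ℝ} (hx : 0 ≤ x) (hP : 0 < P) (hT : 0 < T) (hu : 2 < u) :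
    (x * P ^ 2 * T ^ (-(2 / (u - 2)))) ^ ((u - 2) / 2) * (T * P) =
      x ^ ((u - 2) / 2) * P ^ (u - 1) := by
  have hu2 : u - 2 ≠ 0 := by linarith
  have hexp : -(2 / (u - 2)) * ((u - 2) / 2) = -1 := by field_simp
  rw [← Real.rpow_two, Real.mul_rpow (by positivity) (by positivity),
    Real.mul_rpow hx (by positivity), ← Real.rpow_mul hP.le, ← Real.rpow_mul hT.le, hexp,
    Real.rpow_neg_one, mul_div_cancel₀ _ two_ne_zero, show u - 1 = u - 2 + 1 by ring,
    Real.rpow_add_one hP.ne']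
  field_simp

/-- The error term is just small enough to compensate for the height `T` of `f` in
`∑ ‖f n‖ ^ 2 ≤ T * ∑ ν n`. -/
theorem exists_integral_norm_trigPoly_rpow_le (hu : 2 < u) (ha : 0 ≤ a) (hb : 0 ≤ b) :
    ∃ C, ∀ {s : Finset ℤ} {f : ℤ → ℂ} {ν : ℤ → ℝ} {N : ℕ} {T : ℝ}, 0 < N → 1 ≤ T →
      (∀ n ∈ s, ‖f n‖ ≤ ν n) → (∀ n ∈ s, ‖f n‖ ≤ T) →
      (∀ x, ‖trigPoly s (fun n ↦ ν n) x‖ ≤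
        a * dirichletMajorant N x + b * N * T ^ (-(2 / (u - 2)))) →
      ∫ x, ‖trigPoly s f x‖ ^ u ≤ C * (N : ℝ) ^ (u - 1) := by
  have : 0 < u - 2 := by linarith
  set m := 2 * a + b
  have : 0 ≤ m := by positivity
  refine ⟨(2 * m) ^ (u / 2) * ((2 * a) ^ (u / 2) * ∫ x : ℝ, (1 + ‖x‖) ^ (-(u / 2))) +
    (2 * m * b) ^ ((u - 2) / 2) * m, fun {s f ν N T} hN hT hf hfT hν ↦ ?_⟩
  have hT0 : 0 < T := one_pos.trans_le hT
  have hN' : (0 : ℝ) < N := mod_cast hN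
  set D := b * N * T ^ (-(2 / (u - 2))) with hD
  have hDb : D ≤ b * N := mul_le_of_le_one_right (by positivity)
    (Real.rpow_le_one_of_one_le_of_nonpos hT (by rw [neg_nonpos]; positivity))
  have hM : ∑ n ∈ s, ν n ≤ m * N := (sum_le_of_norm_trigPoly_le hν).trans (by linarith)
  have hmain : ∫ x, ‖trigPoly s f x‖ ^ u ≤
      (2 * (m * N)) ^ (u / 2) * (∫ x, (a * dirichletMajorant N x) ^ (u / 2)) +
        (2 * (m * N) * D) ^ ((u - 2) / 2) * ∑ n ∈ s, ‖f n‖ ^ 2 :=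
    integral_norm_trigPoly_rpow_le (k := a • dirichletMajorant N) hu.le hf hν hM (by positivity)
      fun x ↦ mul_nonneg ha (dirichletMajorant_nonneg N x)
  have hk := mul_le_mul_of_nonneg_left (integral_mul_dirichletMajorant_rpow_le ha hN hu)
    (show 0 ≤ (2 * (m * N)) ^ (u / 2) by positivity)
  have hs := mul_le_mul_of_nonneg_left (sum_norm_sq_le hf hfT hT0.le hM)
    (show 0 ≤ (2 * (m * N) * D) ^ ((u - 2) / 2) by positivity)
  have hfactor : 2 * (m * N) * D = 2 * m * b * N ^ 2 * T ^ (-(2 / (u - 2))) := by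
    rw [hD]
    ring
  have hkernel := mul_rpow_half_mul_rpow (u := u) (show 0 ≤ 2 * m by positivity) hN'
  have herror := mul_sq_mul_rpow_mul_mul (show 0 ≤ 2 * m * b by positivity) hN' hT0 hu
  rw [← hfactor] at herror
  rw [mul_assoc 2 m] at hkernel
  linear_combination hmain + hk + hs +
    (2 * a) ^ (u / 2) * (∫ x : ℝ, (1 + ‖x‖) ^ (-(u / 2))) * hkernel + m * herror

end DirichletMajorant

/-! ### The main estimate -/

/-- The interval of all `n` with `W * n - b ∈ [1, X]`. -/
noncomputable def tauSupport (W b : ℕ) (X : ℝ) : Finset ℤ :=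
  Ioc ((b / W : ℕ) : ℤ) (((⌊X⌋₊ + b) / W : ℕ) : ℤ)

section Support

variable {W b : ℕ} {X : ℝ}

lemma ordConnected_tauSupport : (tauSupport W b X : Set ℤ).OrdConnected := by
  rw [tauSupport, coe_Ioc]
  exact Set.ordConnected_Ioc

lemma mem_tauSupport (hW : 0 < W) (hX : 0 ≤ X) {n : ℤ} :
    n ∈ tauSupport W b X ↔ 1 ≤ (W : ℤ) * n - b ∧ (((W : ℤ) * n - b : ℤ) : ℝ) ≤ X := by
  have hW' : (0 : ℤ) < W := mod_cast hW
  rw [tauSupport, mem_Ioc, ← Int.le_floor, ← Int.natCast_floor_eq_floor hX, Int.natCast_div,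
    Int.natCast_div, Int.ediv_lt_iff_lt_mul hW', Int.le_ediv_iff_mul_le hW', mul_comm n]
  push_cast
  constructor <;> rintro ⟨h₁, h₂⟩ <;> constructor <;> linarith

lemma card_tauSupport_le (hW : 0 < W) : #(tauSupport W b X) ≤ ⌊X / W⌋₊ + 1 := by
  rw [tauSupport, Int.card_Ioc, Nat.floor_div_natCast, Nat.add_div hW]
  generalize ⌊X⌋₊ / W = q
  split_ifs <;> omega

lemma eq_zero_of_notMem_tauSupport {c : ℝ} (hW : 0 < W) (hX : 0 ≤ X) {f : ℤ → ℂ}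
    (hf : ∀ n, ‖f n‖ ≤ tau c W b X n) : ∀ n ∉ tauSupport W b X, f n = 0 := by
  intro n hn
  have h := hf n
  rw [mem_tauSupport hW hX] at hn
  rwa [tau, if_neg fun h ↦ hn h.2, norm_le_zero_iff] at h

lemma tau_le_mul_rpow {c : ℝ} (hc : 1 ≤ c) (hX : 0 ≤ X) (n : ℤ) :
    tau c W b X n ≤ c * X ^ (1 - 1 / c) := by
  have hexp : 0 ≤ 1 - 1 / c := sub_nonneg.2 ((div_le_one (by linarith)).2 hc)
  rw [tau]
  split_ifs with h
  · have hm : (0 : ℝ) ≤ ((W : ℤ) * n - b : ℤ) := Int.cast_nonneg (by linarith [h.2.1])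
    gcongr
    exact h.2.2
  · positivity

lemma fourierSum_eq_trigPoly {s : Finset ℤ} {f : ℤ → ℂ} (hf : ∀ n ∉ s, f n = 0) (x : ℝ) :
    fourierSum f x = trigPoly s f (x : UnitAddCircle) := by
  rw [fourierSum, trigPoly_apply, tsum_eq_sum fun n hn ↦ by rw [hf n hn, zero_mul]]
  refine sum_congr rfl fun n _ ↦ ?_
  rw [fourier_coe_apply]
  push_cast
  ring_nf

lemma integral_norm_fourierSum_rpow {s : Finset ℤ} {f : ℤ → ℂ} (hf : ∀ n ∉ s, f n = 0) (u : ℝ) :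
    ∫ α in (0 : ℝ)..1, ‖fourierSum f α‖ ^ u = ∫ x, ‖trigPoly s f x‖ ^ u := by
  rw [← UnitAddCircle.intervalIntegral_preimage 0, zero_add]
  simp_rw [fourierSum_eq_trigPoly hf]

end Support

lemma four_le_exp_two : (4 : ℝ) ≤ Real.exp 2 := by
  rw [show (2 : ℝ) = 1 + 1 by norm_num, Real.exp_add]
  nlinarith [Real.add_one_le_exp (1 : ℝ)]

lemma trickW_le_log_sq {X : ℝ} (hX : Real.exp (Real.exp 1) < X) :
    (trickW X : ℝ) ≤ Real.log X ^ 2 := by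
  have hX0 : 0 < X := (Real.exp_pos _).trans hX
  have h₁ : Real.exp 1 < Real.log X := (Real.lt_log_iff_exp_lt hX0).2 hX
  have hlog : 0 < Real.log X := (Real.exp_pos _).trans h₁
  have h₂ : 1 < Real.log (Real.log X) := (Real.lt_log_iff_exp_lt hlog).2 h₁
  set L := Real.log (Real.log X) with hL
  have hfloor : (⌊Real.log (Real.log L)⌋₊ : ℝ) ≤ L :=
    (Nat.cast_le.2 (Nat.floor_mono ((Real.log_le_self (Real.log_nonneg h₂.le)).trans
      (Real.log_le_self (by linarith))))).trans (Nat.floor_le (by linarith))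
  calc (trickW X : ℝ) ≤ 4 ^ ⌊Real.log (Real.log L)⌋₊ := mod_cast primorial_le_four_pow _
    _ ≤ Real.exp 2 ^ ⌊Real.log (Real.log L)⌋₊ := by gcongr; exact four_le_exp_two
    _ = Real.exp (⌊Real.log (Real.log L)⌋₊ * 2) := by rw [Real.exp_nat_mul]
    _ ≤ Real.exp (L * 2) := by gcongr
    _ = Real.log X ^ 2 := by rw [mul_two, Real.exp_add, hL, Real.exp_log hlog, sq]

lemma trickW_le_mul_rpow {ε : ℝ} (hε : 0 < ε) {X : ℝ} (hX : Real.exp (Real.exp 1) < X) :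
    (trickW X : ℝ) ≤ (2 / ε) ^ 2 * X ^ ε := by
  have hX1 : 1 < X := (Real.one_lt_exp_iff.2 (Real.exp_pos 1)).trans hX
  calc (trickW X : ℝ) ≤ Real.log X ^ 2 := trickW_le_log_sq hX
    _ ≤ (X ^ (ε / 2) / (ε / 2)) ^ 2 :=
        pow_le_pow_left₀ (Real.log_nonneg hX1.le)
          (Real.log_le_rpow_div (by linarith) (half_pos hε)) 2
    _ = (2 / ε) ^ 2 * (X ^ (ε / 2) * X ^ (ε / 2)) := by ring
    _ = (2 / ε) ^ 2 * X ^ ε := by rw [← Real.rpow_add (by linarith), add_halves]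

theorem exists_norm_trigPoly_fejerMajorant_le {γ : ℝ} (hγ : γ ∈ Set.Ioo 0 1) :
    ∃ K ≥ 0, ∀ {W b : ℕ} {X : ℝ}, 0 < W → 1 ≤ X → ∀ x : UnitAddCircle,
      ‖trigPoly (tauSupport W b X) (fun n ↦ fejerMajorant γ (W * n - b)) x‖ ≤
        96 * dirichletMajorant (⌊X / W⌋₊ + 1) x + K * (W ^ 2 * X ^ (3 / 2 - γ)) := by
  have hgeom : 1 < (2 : ℝ) ^ (3 / 2 - γ) := Real.one_lt_rpow one_lt_two (by linarith [hγ.2])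
  refine ⟨96 * (192 / √(γ * (1 - γ)) * (2 ^ (3 / 2 - γ) / (2 ^ (3 / 2 - γ) - 1))),
    mul_nonneg (by norm_num) (mul_nonneg (by positivity) (div_nonneg (by positivity)
      (sub_nonneg.2 hgeom.le))), fun {W b X} hW hX x ↦ ?_⟩
  obtain ⟨x, rfl⟩ := QuotientAddGroup.mk_surjective x
  have hrange (n : ℤ) (hn : n ∈ tauSupport W b X) : (W * n - b : ℝ) ∈ Set.Icc 1 X := by
    rw [mem_tauSupport hW (by linarith)] at hn
    exact ⟨mod_cast hn.1, mod_cast hn.2⟩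
  have hsum := norm_sum_fejerMajorant_le hγ (mod_cast hW) hX ordConnected_tauSupport hrange x
  have hdirichlet := norm_sum_fourierChar_mul_le_dirichletMajorant ordConnected_tauSupport
    (card_tauSupport_le (b := b) (X := X) hW) x
  simp only [trigPoly_apply, fourier_coe_eq_fourierChar]
  linarith

lemma sq_mul_rpow_le {A N X e w γ ε : ℝ} (hX : 0 < X) (hw : 0 ≤ w) (hXN : X ≤ N * w)
    (hwA : w ≤ A * X ^ ε) (hε : 3 * ε = γ - 1 / 2 - e) :
    w ^ 2 * X ^ (3 / 2 - γ) ≤ A ^ 3 * N * X ^ (-e) := by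
  have hN : 0 ≤ N := (pos_of_mul_pos_left (hX.trans_le hXN) hw).le
  calc w ^ 2 * X ^ (3 / 2 - γ) = w ^ 2 * X ^ (1 / 2 - γ) * X := by
        rw [mul_assoc, ← Real.rpow_add_one hX.ne']
        ring_nf
    _ ≤ w ^ 2 * X ^ (1 / 2 - γ) * (N * w) := by gcongr
    _ = w ^ 3 * N * X ^ (1 / 2 - γ) := by ring
    _ ≤ (A * X ^ ε) ^ 3 * N * X ^ (1 / 2 - γ) := by gcongr
    _ = A ^ 3 * N * (X ^ (ε * 3) * X ^ (1 / 2 - γ)) := by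
        rw [Real.rpow_mul hX.le, Real.rpow_ofNat]
        ring
    _ = A ^ 3 * N * X ^ (-e) := by
        rw [← Real.rpow_add hX, show ε * 3 + (1 / 2 - γ) = -e by linarith]

lemma rpow_neg_mul_eq {c X α p : ℝ} (hc : 0 < c) (hX : 0 ≤ X) :
    X ^ (-(α * p)) = c ^ p * (c * X ^ α) ^ (-p) := by
  rw [Real.mul_rpow hc.le (by positivity), ← mul_assoc, ← Real.rpow_add hc, add_neg_cancel,
    Real.rpow_zero, one_mul, ← Real.rpow_mul hX, mul_neg]

/-- Beyond the threshold for `u`, the factor `X ^ (1 / c - 1 / 2)` saved by van der Corput's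
inequality exceeds the factor lost to the height `T ≍ X ^ (1 - 1 / c)` of `f`, which is
`T ^ (2 / (u - 2))`. -/
lemma one_sub_mul_two_div_lt {c u : ℝ} (hc1 : 1 < c) (hc2 : c < 2)
    (hu : 2 + 4 * (c - 1) / (2 - c) < u) :
    (1 - 1 / c) * (2 / (u - 2)) < 1 / c - 1 / 2 := by
  have hc : 0 < 4 * (c - 1) / (2 - c) := div_pos (by linarith) (by linarith)
  have hu2 : 0 < u - 2 := by linarith
  have hthreshold : 4 * (c - 1) < (u - 2) * (2 - c) := by
    rw [← div_lt_iff₀ (by linarith)]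
    linarith
  have hdiff : 1 / c - 1 / 2 - (1 - 1 / c) * (2 / (u - 2)) =
      ((u - 2) * (2 - c) - 4 * (c - 1)) / (2 * c * (u - 2)) := by
    field_simp
    ring
  rw [← sub_pos, hdiff]
  exact div_pos (by linarith) (by positivity)

theorem lemma3p2_general {c u : ℝ} (hc1 : 1 < c) (hc2 : c < 2)
    (hu : 2 + 4 * (c - 1) / (2 - c) < u) :
    ∃ ε : ℝ, 0 < ε ∧ ∀ A : ℝ, ∃ C : ℝ, ∀ X : ℝ, 1 ≤ X → ∀ W : ℕ, 0 < W → W ≤ A * X ^ ε →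
      ∀ (b : ℕ) (f : ℤ → ℂ), (∀ n, ‖f n‖ ≤ tau c W b X n) →
        ∫ α in (0 : ℝ)..1, ‖fourierSum f α‖ ^ u ≤ C * ((⌊X / W⌋₊ + 1 : ℕ) : ℝ) ^ (u - 1) := by
  have hc0 : 0 < c := by linarith
  have hc : 1 / c ∈ Set.Ioo 0 1 := ⟨by positivity, (div_lt_one hc0).2 hc1⟩
  have hu2 : 2 < u := by
    have : 0 < 4 * (c - 1) / (2 - c) := div_pos (by linarith) (by linarith)
    linarith
  obtain ⟨K, hK, hmajorant⟩ := exists_norm_trigPoly_fejerMajorant_le hc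
  refine ⟨(1 / c - 1 / 2 - (1 - 1 / c) * (2 / (u - 2))) / 3,
    by linarith [one_sub_mul_two_div_lt hc1 hc2 hu], fun A ↦ ?_⟩
  obtain ⟨C, hC⟩ := exists_integral_norm_trigPoly_rpow_le (a := 96)
    (b := K * |A| ^ 3 * c ^ (2 / (u - 2))) hu2 (by norm_num) (by positivity)
  refine ⟨C, fun X hX W hW hWA b f hf ↦ ?_⟩
  have hX0 : 0 < X := by linarith
  have hW0 : (0 : ℝ) < W := mod_cast hW
  have hXN : X ≤ ((⌊X / W⌋₊ + 1 : ℕ) : ℝ) * W := by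
    rw [← div_le_iff₀ hW0, Nat.cast_add_one]
    exact (Nat.lt_floor_add_one _).le
  have herror := sq_mul_rpow_le hX0 hW0.le hXN
    (hWA.trans (mul_le_mul_of_nonneg_right (le_abs_self A) (by positivity)))
    (mul_div_cancel₀ _ three_ne_zero)
  rw [rpow_neg_mul_eq hc0 hX0.le] at herror
  rw [integral_norm_fourierSum_rpow (eq_zero_of_notMem_tauSupport hW hX0.le hf)]
  refine hC (T := c * X ^ (1 - 1 / c)) (ν := fun n ↦ fejerMajorant (1 / c) (W * n - b))
    (Nat.succ_pos _) ?_ (fun n hn ↦ ?_) (fun n _ ↦ (hf n).trans (tau_le_mul_rpow hc1.le hX0.le n))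
    fun x ↦ (hmajorant hW hX x).trans ?_
  · exact one_le_mul_of_one_le_of_one_le hc1.le (Real.one_le_rpow hX (by linarith [hc.2]))
  · exact (hf n).trans (tau_le_fejerMajorant hc1 hc2 ((mem_tauSupport hW hX0.le).1 hn).1)
  · linarith [mul_le_mul_of_nonneg_left herror hK]

end PiatetskiShapiro

theorem lemma3p2 (c : ℝ) (hc1 : 1 < c) (hc2 : c < 2)
    (u : ℝ) (hu : 2 + 4 * (c - 1) / (2 - c) < u) :
    ∃ C : ℝ, ∀ X : ℝ, Real.exp (Real.exp 1) < X →
      ∀ b : ℕ, b < PiatetskiShapiro.trickW X → Nat.Coprime b (PiatetskiShapiro.trickW X) →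
        ∀ f : ℤ → ℂ,
          (∀ n : ℤ, ‖f n‖ ≤ PiatetskiShapiro.tau c (PiatetskiShapiro.trickW X) b X n) →
          ∫ α in (0 : ℝ)..1, ‖PiatetskiShapiro.fourierSum f α‖ ^ u ≤
            C * (PiatetskiShapiro.trickN X : ℝ) ^ (u - 1) := by
  obtain ⟨ε, hε, h⟩ := PiatetskiShapiro.lemma3p2_general hc1 hc2 hu
  exact (h ((2 / ε) ^ 2)).imp fun C hC X hX b _ _ ↦
    hC X ((Real.one_lt_exp_iff.2 (Real.exp_pos 1)).trans hX).le _ (primorial_pos _)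
      (PiatetskiShapiro.trickW_le_mul_rpow hε hX) b
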